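/- **Theorem 2.1 (Uniform Bahadur representation).** *Setting.* For each sample size $n$ let $(\mathcal W,\mathcal A_{\mathcal W})$ be a measurable space, $\mathcal P_n$ a set of probability measures on it, $\mathcal U\subset\mathbb R^{d_u}$ and $[\tilde p]=\{1,\dots,\tilde p\}$ index sets (all of these, and the objects below, may depend on $n$; no bound is imposed on $d_u$ or $\tilde p$). For $u\in\mathcal U$, $j\in[\tilde p]$ let $\Theta_{uj}\subset\mathbb R$ be an interval, $T_{uj}$ a convex subset of a real vector space with a norm (or only a seminorm) $\|\cdot\|_e$, and $\psi_{uj}(w,\theta,\eta)$ a real-valued score. For $P\in\mathcal P_n$ let $\theta_{uj}\in\Theta_{uj}$, $\eta_{uj}\in T_{uj}$ and $\mathcal T_{uj}\subset T_{uj}$; these and $\|\cdot\|_e$ may depend on $P$. Under $\Pr_P$, the data $W_1,\dots,W_n$ are i.i.d. with law $P$. Write $\mathbb E_n[f]=n^{-1}\sum_{i=1}^n f(W_i)$, $\mathbb G_n f=\sqrt n(\mathbb E_n[f]-\mathrm E_P[f(W)])$ and $$\mathcal S_n=\mathrm E_P\Big[\sup_{u\in\mathcal U,j\in[\tilde p]}\big|\sqrt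 n\,\mathbb E_n[\psi_{uj}(W,\theta_{uj},\eta_{uj})]\big|\Big],\qquad J_{uj}=\partial_\theta \mathrm E_P[\psi_{uj}(W,\theta,\eta_{uj})]\big|_{\theta=\theta_{uj}} .$$ Let $C_0,c_0,\omega>0$, $q\ge2$, $n_0\ge3$ be constants; $(\delta_n),(\Delta_n),(\tau_n)$ positive sequences converging to zero; $(B_{1n}),(B_{2n}),(a_n),(v_n),(K_n)$ positive sequences with $B_{1n}\ge1$, $a_n\ge n\vee K_n$, $v_n\ge1$. None of these depends on $P$. Expectations and probabilities of possibly non-measurable suprema and events are outer ones. *Assumption A (moment conditions).* For all $n\ge n_0$, $P\in\mathcal P_n$, $u\in\mathcal U$, $j\in[\tilde p]$: (i) $\mathrm E_P[\psi_{uj}(W,\theta_{uj},\eta_{uj})]=0$, $\mathcal S_n<\infty$, and $\Theta_{uj}$ contains the ball of radius $C_0n^{-1/2}\mathcal S_n\log n$ centered at $\theta_{uj}$. (ii) $(\theta,\eta)\mapsto \mathrm E_P[\psi_{uj}(W,\theta,\eta)]$ is twice continuously Gateaux-differentiable on $\Theta_{uj}\times\mathcal T_{uj}$, in the sense that for each $\eta\in\mathcal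 T_{uj}$ the map $(\theta,r)\mapsto \mathrm E_P[\psi_{uj}(W,\theta,\eta_{uj}+r(\eta-\eta_{uj}))]$ is $C^2$ on $\Theta_{uj}\times[0,1]$. (iii) (near-orthogonality) For all $\eta\in\mathcal T_{uj}$, the derivative $\partial_r \mathrm E_P[\psi_{uj}(W,\theta_{uj},\eta_{uj}+r(\eta-\eta_{uj}))]$ exists for all $r\in[0,1)$, and at $r=0$ its absolute value is at most $C_0\delta_nn^{-1/2}$. (iv) $|\mathrm E_P[\psi_{uj}(W,\theta,\eta_{uj})]|\ge \{2^{-1}|J_{uj}(\theta-\theta_{uj})|\}\wedge c_0$ for all $\theta\in\Theta_{uj}$, and $c_0\le|J_{uj}|\le C_0$. (v) For all $r\in[0,1)$, $\theta\in\Theta_{uj}$, $\eta\in\mathcal T_{uj}$: (a) $\mathrm E_P[(\psi_{uj}(W,\theta,\eta)-\psi_{uj}(W,\theta_{uj},\eta_{uj}))^2]\le C_0(|\theta-\theta_{uj}|\vee\|\eta-\eta_{uj}\|_e)^\omega$; (b) $|\partial_r \mathrm E_P[\psi_{uj}(W,\theta,\eta_{uj}+r(\eta-\eta_{uj}))]|\le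 B_{1n}\|\eta-\eta_{uj}\|_e$; (c) $|\partial_r^2 \mathrm E_P[\psi_{uj}(W,\theta_{uj}+r(\theta-\theta_{uj}),\eta_{uj}+r(\eta-\eta_{uj}))]|\le B_{2n}(|\theta-\theta_{uj}|^2\vee\|\eta-\eta_{uj}\|_e^2)$. *Assumption B (nuisance estimation).* For all $n\ge n_0$, $P\in\mathcal P_n$, with estimators $\hat\eta_{uj}$ of $\eta_{uj}$: (i) with $\Pr_P$-probability at least $1-\Delta_n$, $\hat\eta_{uj}\in\mathcal T_{uj}$ for all $u,j$; (ii) $\|\eta-\eta_{uj}\|_e\le\tau_n$ for all $u,j$ and $\eta\in\mathcal T_{uj}$; (iii) $\eta_{uj}\in\mathcal T_{uj}$ for all $u,j$; (iv) $\mathcal F_1=\{\psi_{uj}(\cdot,\theta,\eta):u\in\mathcal U,j\in[\tilde p],\theta\in\Theta_{uj},\eta\in\mathcal T_{uj}\}$ is an image admissible Suslin class and has a measurable envelope $F_1$ with $\|F_1\|_{P,q}\le K_n$ and, with $Q$ ranging over the finitely discrete probability measures, $\sup_Q\log N(\epsilon\|F_1\|_{Q,2},\mathcal F_1,\|\cdot\|_{Q,2})\le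 v_n\log(a_n/\epsilon)$ for all $0<\epsilon\le1$; (v) $c_0\le\|f\|_{P,2}\le C_0$ for all $f\in\mathcal F_1$; (vi) $(v_n\log a_n/n)^{1/2}\le C_0\tau_n$; $(B_{1n}\tau_n+\mathcal S_n\log n/\sqrt n)^{\omega/2}(v_n\log a_n)^{1/2}+n^{-1/2+1/q}v_nK_n\log a_n\le C_0\delta_n$; and $n^{1/2}B_{1n}^2B_{2n}\tau_n^2\le C_0\delta_n$. *Estimator.* Let $\epsilon_n=o(\delta_nn^{-1/2})$ be constants and let $\check\theta_{uj}\in\Theta_{uj}$ satisfy, $\Pr_P$-almost surely for all $n\ge n_0$ and $P\in\mathcal P_n$, $$\sup_{u\in\mathcal U,j\in[\tilde p]}\Big\{\big|\mathbb E_n[\psi_{uj}(W,\check\theta_{uj},\hat\eta_{uj})]\big|-\inf_{\theta\in\Theta_{uj}}\big|\mathbb E_n[\psi_{uj}(W,\theta,\hat\eta_{uj})]\big|\Big\}\le\epsilon_n .$$ *Conclusion.* Let $\sigma_{uj}>0$ be given by $\sigma_{uj}^2=J_{uj}^{-2}\mathrm E_P[\psi_{uj}^2(W,\theta_{uj},\eta_{uj})]$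 and put $\bar\psi_{uj}=-\sigma_{uj}^{-1}J_{uj}^{-1}\psi_{uj}(\cdot,\theta_{uj},\eta_{uj})$. Then $$\sqrt n\,\sigma_{uj}^{-1}(\check\theta_{uj}-\theta_{uj})=\mathbb G_n\bar\psi_{uj}+O_P(\delta_n)\quad\text{in }\ell^\infty(\mathcal U\times[\tilde p]),\text{ uniformly over }P\in\mathcal P_n,$$ that is, for each $\varepsilon>0$ there are $C$ and $N$ such that for all $n\ge N$ and all $P\in\mathcal P_n$, $$\Pr\nolimits_P\Big(\sup_{u\in\mathcal U,j\in[\tilde p]}\big|\sqrt n\,\sigma_{uj}^{-1}(\check\theta_{uj}-\theta_{uj})-\mathbb G_n\bar\psi_{uj}\big|>C\delta_n\Big)\le\varepsilon .$$ -/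

import Mathlib

open MeasureTheory ProbabilityTheory Filter Set
open scoped ENNReal NNReal

noncomputable section

/-! ### Empirical means, empirical processes, outer expectations, sampling -/

/-- The empirical mean `𝔼ₙ[f] = n⁻¹ ∑ᵢ f(wᵢ)` at the data points `w₁, …, wₙ`. -/
def empMean {𝒲 : Type*} {n : ℕ} (w : Fin n → 𝒲) (f : 𝒲 → ℝ) : ℝ :=
  (n : ℝ)⁻¹ * ∑ i, f (w i)

/-- The empirical process `𝔾ₙ f = √n (𝔼ₙ[f] - E_P[f])` at the data points `w₁, …, wₙ`. -/
def empProcess {𝒲 : Type*} [MeasurableSpace 𝒲] {n : ℕ} (P : Measure 𝒲) (w : Fin n → 𝒲)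
    (f : 𝒲 → ℝ) : ℝ :=
  Real.sqrt n * (empMean w f - ∫ x, f x ∂P)

/-- The outer expectation of a `[0,∞]`-valued function. It is the ordinary expectation when the
function is measurable; suprema over uncountable index sets need not be. -/
def outerExpectation {Ω : Type*} [MeasurableSpace Ω] (μ : Measure Ω) (X : Ω → ℝ≥0∞) : ℝ≥0∞ :=
  ⨅ (g : Ω → ℝ≥0∞) (_ : Measurable g) (_ : X ≤ g), ∫⁻ ω, g ω ∂μ

/-- Under the probability measure `μ`, the random elements `W 0, …, W (n-1)` are independent with
common distribution `P`. -/
structure IsRandomSample {𝒲 Ω : Type*} [MeasurableSpace 𝒲] [MeasurableSpace Ω] {n : ℕ}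
    (W : Fin n → Ω → 𝒲) (P : Measure 𝒲) (μ : Measure Ω) : Prop where
  isProbabilityMeasure : IsProbabilityMeasure μ
  measurable : ∀ i, Measurable (W i)
  map_eq : ∀ i, μ.map (W i) = P
  indep : iIndepFun W μ

/-- `Rₙ = O_P(bₙ)` uniformly over `P ∈ Pset n`, for nonnegative, possibly non-measurable `Rₙ`:
for each `ε > 0` there is a constant `C`, which depends neither on `n` nor on `P`, such that
`Pr_P(Rₙ > C bₙ) ≤ ε` for all sufficiently large `n` and all `P ∈ Pset n`. On a non-measurable set
a measure takes the value of its outer measure, so this is a statement on outer probabilities. -/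
def UniformBigOP {𝒬 Ω : ℕ → Type*} [∀ n, MeasurableSpace (Ω n)] (Pset : ∀ n, Set (𝒬 n))
    (Pr : ∀ n, 𝒬 n → Measure (Ω n)) (R : ∀ n, 𝒬 n → Ω n → ℝ≥0∞) (b : ℕ → ℝ) : Prop :=
  ∀ ε : ℝ, 0 < ε → ∃ C : ℝ, 0 < C ∧ ∃ N : ℕ, ∀ n, N ≤ n → ∀ P ∈ Pset n,
    Pr n P {ω | ENNReal.ofReal (C * b n) < R n P ω} ≤ ENNReal.ofReal ε

/-! ### Function classes -/

/-- Suitable measurability: `F` is an image admissible Suslin class, i.e. `F = {T y : y ∈ Y}` with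
`(w, y) ↦ T y w` jointly measurable and `Y` a Suslin measurable space. A Suslin measurable space is
a Borel image of a standard Borel space, so `Y` may be taken to be standard Borel itself; and
standard Borel spaces of all universes are isomorphic to ones in `Type`. -/
def SuitablyMeasurable {𝒲 : Type*} [MeasurableSpace 𝒲] (F : Set (𝒲 → ℝ)) : Prop :=
  ∃ (Y : Type) (_ : MeasurableSpace Y) (_ : StandardBorelSpace Y) (T : Y → 𝒲 → ℝ),
    range T = F ∧ Measurable (fun x : 𝒲 × Y => T x.2 x.1)

/-- `‖f‖_{Q,2}` for the finitely discrete measure `Q` with mass `Q w` at the point `w`. -/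
def discreteL2 {𝒲 : Type*} (Q : 𝒲 →₀ ℝ≥0) (f : 𝒲 → ℝ) : ℝ :=
  Real.sqrt (Q.sum fun w m => (m : ℝ) * f w ^ 2)

/-- The covering number `N(r, F, ‖·‖_{Q,2})`: the least number of `‖·‖_{Q,2}`-balls of radius `r`
that cover `F` (`⊤` if there is no finite cover). -/
def coverNum {𝒲 : Type*} (r : ℝ) (F : Set (𝒲 → ℝ)) (Q : 𝒲 →₀ ℝ≥0) : ℕ∞ :=
  ⨅ (G : Finset (𝒲 → ℝ)) (_ : ∀ f ∈ F, ∃ g ∈ G, discreteL2 Q (f - g) ≤ r), (G.card : ℕ∞)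

/-- Uniform entropy bound:
`sup_Q log N(ε ‖Fenv‖_{Q,2}, F, ‖·‖_{Q,2}) ≤ v log (a/ε)` for all `0 < ε ≤ 1`, the supremum being
over all finitely discrete probability measures `Q`. -/
def UniformEntropyBound {𝒲 : Type*} (F : Set (𝒲 → ℝ)) (Fenv : 𝒲 → ℝ) (v a : ℝ) : Prop :=
  ∀ ε : ℝ, 0 < ε → ε ≤ 1 → ∀ Q : 𝒲 →₀ ℝ≥0, (Q.sum fun _ m => m) = 1 →
    ENNReal.log ((coverNum (ε * discreteL2 Q Fenv) F Q : ℕ∞) : ℝ≥0∞)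
      ≤ ((v * Real.log (a / ε) : ℝ) : EReal)

/-! ### The moment-condition model -/

/-- The moment-condition model at a fixed sample size: index set `U ⊆ ℝᵈ`, number `p` of targets,
data space `𝒲`, real vector space `E` containing the nuisance parameters.

The true parameters, the neighbourhoods `𝒯` of the true nuisance parameters and the norm depend on
the distribution `P` of the data. The norm is only asked to be a seminorm, so that, for instance,
`L²(P)`-norms on spaces of functions are covered for all `P` at the same time. -/
structure MomentModel (𝒲 E : Type*) [MeasurableSpace 𝒲] [AddCommGroup E] [Module ℝ E]
    (d p : ℕ) where
  /-- the index set -/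
  U : Set (EuclideanSpace ℝ (Fin d))
  /-- the score functions `ψ_{uj}(w, θ, η)`; values at `η ∉ T u j` or `θ ∉ Θ u j` are irrelevant -/
  ψ : U → Fin p → 𝒲 → ℝ → E → ℝ
  /-- the parameter spaces `Θ_{uj}`, which are intervals -/
  Θ : U → Fin p → Set ℝ
  /-- the convex sets `T_{uj}` of possible nuisance parameters -/
  T : U → Fin p → Set E
  /-- the set of possible distributions of `W` -/
  Pset : Set (ProbabilityMeasure 𝒲)
  /-- the true target parameters `θ_{uj}` -/
  θ₀ : ProbabilityMeasure 𝒲 → U → Fin p → ℝ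
  /-- the true nuisance parameters `η_{uj}` -/
  η₀ : ProbabilityMeasure 𝒲 → U → Fin p → E
  /-- the subsets `𝒯_{uj}` of `T_{uj}` in which the nuisance estimators lie with high probability -/
  𝒯 : ProbabilityMeasure 𝒲 → U → Fin p → Set E
  /-- the norm `‖·‖ₑ` -/
  nrm : ProbabilityMeasure 𝒲 → U → Fin p → Seminorm ℝ E
  Θ_interval : ∀ u j, (Θ u j).OrdConnected
  T_convex : ∀ u j, Convex ℝ (T u j)
  θ₀_mem : ∀ P ∈ Pset, ∀ u j, θ₀ P u j ∈ Θ u j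
  η₀_mem : ∀ P ∈ Pset, ∀ u j, η₀ P u j ∈ T u j
  𝒯_subset : ∀ P ∈ Pset, ∀ u j, 𝒯 P u j ⊆ T u j

namespace MomentModel

variable {𝒲 E : Type*} [MeasurableSpace 𝒲] [AddCommGroup E] [Module ℝ E] {d p : ℕ}

/-- The moment function `(θ, η) ↦ E_P[ψ_{uj}(W, θ, η)]`. -/
def mean (M : MomentModel 𝒲 E d p) (P : ProbabilityMeasure 𝒲) (u : M.U) (j : Fin p)
    (θ : ℝ) (η : E) : ℝ :=
  ∫ w, M.ψ u j w θ η ∂(P : Measure 𝒲)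

/-- The score at the true parameters, `w ↦ ψ_{uj}(w, θ_{uj}, η_{uj})`. -/
def trueScore (M : MomentModel 𝒲 E d p) (P : ProbabilityMeasure 𝒲) (u : M.U) (j : Fin p) :
    𝒲 → ℝ :=
  fun w => M.ψ u j w (M.θ₀ P u j) (M.η₀ P u j)

/-- `J_{uj} = ∂_θ E_P[ψ_{uj}(W, θ, η_{uj})]` at `θ = θ_{uj}`. -/
def J (M : MomentModel 𝒲 E d p) (P : ProbabilityMeasure 𝒲) (u : M.U) (j : Fin p) : ℝ :=
  deriv (fun θ => M.mean P u j θ (M.η₀ P u j)) (M.θ₀ P u j)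

/-- `σ_{uj}`, the positive root of `σ_{uj}² = J_{uj}⁻² E_P[ψ_{uj}(W, θ_{uj}, η_{uj})²]`. -/
def σ (M : MomentModel 𝒲 E d p) (P : ProbabilityMeasure 𝒲) (u : M.U) (j : Fin p) : ℝ :=
  Real.sqrt ((M.J P u j ^ 2)⁻¹ * ∫ w, M.trueScore P u j w ^ 2 ∂(P : Measure 𝒲))

/-- `ψ̄_{uj} = - σ_{uj}⁻¹ J_{uj}⁻¹ ψ_{uj}(·, θ_{uj}, η_{uj})`. -/
def ψbar (M : MomentModel 𝒲 E d p) (P : ProbabilityMeasure 𝒲) (u : M.U) (j : Fin p) : 𝒲 → ℝ :=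
  fun w => -((M.σ P u j)⁻¹ * (M.J P u j)⁻¹ * M.trueScore P u j w)

/-- `𝒮ₙ = E_P[sup_{u,j} |√n 𝔼ₙ[ψ_{uj}(W, θ_{uj}, η_{uj})]|]`, the expectation over a random sample
of size `n` from `P`. -/
def S (M : MomentModel 𝒲 E d p) (n : ℕ) (P : ProbabilityMeasure 𝒲) : ℝ≥0∞ :=
  outerExpectation (Measure.pi fun _ : Fin n => (P : Measure 𝒲)) fun w =>
    ⨆ (u : M.U) (j : Fin p), ‖Real.sqrt n * empMean w (M.trueScore P u j)‖ₑ

/-- The function class `ℱ₁ = {ψ_{uj}(·, θ, η) : u ∈ U, j ∈ [p], θ ∈ Θ_{uj}, η ∈ 𝒯_{uj}}`. -/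
def F₁ (M : MomentModel 𝒲 E d p) (P : ProbabilityMeasure 𝒲) : Set (𝒲 → ℝ) :=
  {f | ∃ (u : M.U) (j : Fin p), ∃ θ ∈ M.Θ u j, ∃ η ∈ M.𝒯 P u j, f = fun w => M.ψ u j w θ η}

end MomentModel

/-- Twice continuous Gateaux differentiability of a function `m` of `(θ, η)` on `Θ × 𝒯`, in the
directions of `θ` and of `η - η₀`, `η ∈ 𝒯`: along each segment from `η₀` to a point `η` of `𝒯`,
`(θ, r) ↦ m(θ, η₀ + r(η - η₀))` is twice continuously differentiable on `Θ × [0,1]` (one-sidedly at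
the boundary). No differentiability in any further direction is required. -/
def TwiceContGateauxOn {E : Type*} [AddCommGroup E] [Module ℝ E] (m : ℝ → E → ℝ) (Θ : Set ℝ)
    (η₀ : E) (𝒯 : Set E) : Prop :=
  ∀ η ∈ 𝒯, ContDiffOn ℝ 2 (fun x : ℝ × ℝ => m x.1 (η₀ + x.2 • (η - η₀))) (Θ ×ˢ Icc (0 : ℝ) 1)

/-- Near-orthogonality: the Gateaux derivatives `∂_r m(η₀ + r(η - η₀))` of
`m(η) = E_P[ψ(W, θ₀, η)]` exist at all `r ∈ [0,1)` and are bounded by `b` at `r = 0`. The derivative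
is taken along the segment from `η₀` to `η`, so that it is one-sided at `r = 0`. -/
def NearOrthogonal {E : Type*} [AddCommGroup E] [Module ℝ E] (m : E → ℝ) (η₀ : E) (𝒯 : Set E)
    (b : ℝ) : Prop :=
  ∀ η ∈ 𝒯,
    (∀ r ∈ Ico (0 : ℝ) 1,
      DifferentiableWithinAt ℝ (fun r : ℝ => m (η₀ + r • (η - η₀))) (Icc 0 1) r) ∧
    |derivWithin (fun r : ℝ => m (η₀ + r • (η - η₀))) (Icc 0 1) 0| ≤ b

/-! ### Constants and assumptions -/

/-- The constants and the sequences of constants, none of which depends on `P`. -/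
structure Rates where
  C₀ : ℝ
  c₀ : ℝ
  ω : ℝ
  q : ℝ
  n₀ : ℕ
  δ : ℕ → ℝ
  Δ : ℕ → ℝ
  τ : ℕ → ℝ
  B₁ : ℕ → ℝ
  B₂ : ℕ → ℝ
  a : ℕ → ℝ
  v : ℕ → ℝ
  K : ℕ → ℝ
  C₀_pos : 0 < C₀
  c₀_pos : 0 < c₀
  ω_pos : 0 < ω
  two_le_q : 2 ≤ q
  three_le_n₀ : 3 ≤ n₀
  δ_pos : ∀ n, 1 ≤ n → 0 < δ n
  δ_tendsto : Tendsto δ atTop (nhds 0)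
  Δ_pos : ∀ n, 1 ≤ n → 0 < Δ n
  Δ_tendsto : Tendsto Δ atTop (nhds 0)
  τ_pos : ∀ n, 1 ≤ n → 0 < τ n
  τ_tendsto : Tendsto τ atTop (nhds 0)
  one_le_B₁ : ∀ n, 1 ≤ n → 1 ≤ B₁ n
  B₂_pos : ∀ n, 1 ≤ n → 0 < B₂ n
  le_a : ∀ n : ℕ, 1 ≤ n → max (n : ℝ) (K n) ≤ a n
  one_le_v : ∀ n, 1 ≤ n → 1 ≤ v n
  K_pos : ∀ n, 1 ≤ n → 0 < K n

/-- Conditions on the score functions and the true parameter values, at sample size `n` and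
distribution `P`. -/
structure MomentConditions {𝒲 E : Type*} [MeasurableSpace 𝒲] [AddCommGroup E] [Module ℝ E]
    {d p : ℕ} (k : Rates) (n : ℕ) (M : MomentModel 𝒲 E d p) (P : ProbabilityMeasure 𝒲) :
    Prop where
  /-- the moment condition -/
  moment : ∀ u j, M.mean P u j (M.θ₀ P u j) (M.η₀ P u j) = 0
  /-- `𝒮ₙ` is a finite number -/
  S_ne_top : M.S n P ≠ ⊤
  /-- the true value is separated from the boundary of the parameter space -/
  ball_subset : ∀ u j,
    Metric.ball (M.θ₀ P u j) (k.C₀ * (Real.sqrt n)⁻¹ * (M.S n P).toReal * Real.log n) ⊆ M.Θ u j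
  /-- smoothness -/
  smooth : ∀ u j, TwiceContGateauxOn (M.mean P u j) (M.Θ u j) (M.η₀ P u j) (M.𝒯 P u j)
  /-- near-orthogonality -/
  orthogonal : ∀ u j, NearOrthogonal (M.mean P u j (M.θ₀ P u j)) (M.η₀ P u j) (M.𝒯 P u j)
    (k.C₀ * k.δ n * (Real.sqrt n)⁻¹)
  /-- identifiability -/
  identif : ∀ u j, ∀ θ ∈ M.Θ u j,
    min (2⁻¹ * |M.J P u j * (θ - M.θ₀ P u j)|) k.c₀ ≤ |M.mean P u j θ (M.η₀ P u j)|
  J_bounds : ∀ u j, k.c₀ ≤ |M.J P u j| ∧ |M.J P u j| ≤ k.C₀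
  /-- mean-square continuity of the score at the true parameters -/
  meanSquare : ∀ u j, ∀ θ ∈ M.Θ u j, ∀ η ∈ M.𝒯 P u j,
    ∫ w, (M.ψ u j w θ η - M.trueScore P u j w) ^ 2 ∂(P : Measure 𝒲)
      ≤ k.C₀ * (max |θ - M.θ₀ P u j| (M.nrm P u j (η - M.η₀ P u j))) ^ k.ω
  /-- first derivative along segments -/
  deriv_bound : ∀ u j, ∀ r ∈ Ico (0 : ℝ) 1, ∀ θ ∈ M.Θ u j, ∀ η ∈ M.𝒯 P u j,
    |derivWithin (fun r : ℝ => M.mean P u j θ (M.η₀ P u j + r • (η - M.η₀ P u j))) (Icc 0 1) r|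
      ≤ k.B₁ n * M.nrm P u j (η - M.η₀ P u j)
  /-- second derivative along segments -/
  deriv2_bound : ∀ u j, ∀ r ∈ Ico (0 : ℝ) 1, ∀ θ ∈ M.Θ u j, ∀ η ∈ M.𝒯 P u j,
    |iteratedDerivWithin 2 (fun r : ℝ => M.mean P u j (M.θ₀ P u j + r * (θ - M.θ₀ P u j))
        (M.η₀ P u j + r • (η - M.η₀ P u j))) (Icc 0 1) r|
      ≤ k.B₂ n * max (|θ - M.θ₀ P u j| ^ 2) (M.nrm P u j (η - M.η₀ P u j) ^ 2)

/-- Conditions on the estimators `ηhat` of the nuisance parameters and on the complexity of the sets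
`𝒯_{uj}`, at sample size `n` and distribution `P`; `μ` is the probability measure `Pr_P` on the
sample space `Ω`. -/
structure NuisanceConditions {𝒲 E Ω : Type*} [MeasurableSpace 𝒲] [AddCommGroup E] [Module ℝ E]
    [MeasurableSpace Ω] {d p : ℕ} (k : Rates) (n : ℕ) (M : MomentModel 𝒲 E d p)
    (P : ProbabilityMeasure 𝒲) (μ : Measure Ω) (ηhat : Ω → M.U → Fin p → E) : Prop where
  /-- with probability at least `1 - Δₙ`, all estimators lie in the sets `𝒯_{uj}` -/
  ηhat_mem : μ {ω | ¬ ∀ u j, ηhat ω u j ∈ M.𝒯 P u j} ≤ ENNReal.ofReal (k.Δ n)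
  nrm_le : ∀ u j, ∀ η ∈ M.𝒯 P u j, M.nrm P u j (η - M.η₀ P u j) ≤ k.τ n
  η₀_mem : ∀ u j, M.η₀ P u j ∈ M.𝒯 P u j
  suitablyMeasurable : SuitablyMeasurable (M.F₁ P)
  /-- uniform entropy, with a measurable envelope whose `L^q(P)`-norm is at most `Kₙ` -/
  entropy : ∃ F : 𝒲 → ℝ, Measurable F ∧ (∀ f ∈ M.F₁ P, ∀ w, |f w| ≤ F w) ∧
    eLpNorm F (ENNReal.ofReal k.q) (P : Measure 𝒲) ≤ ENNReal.ofReal (k.K n) ∧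
    UniformEntropyBound (M.F₁ P) F (k.v n) (k.a n)
  /-- scaling of the score -/
  L2_bounds : ∀ f ∈ M.F₁ P, ENNReal.ofReal k.c₀ ≤ eLpNorm f 2 (P : Measure 𝒲) ∧
    eLpNorm f 2 (P : Measure 𝒲) ≤ ENNReal.ofReal k.C₀
  growth_a : Real.sqrt (k.v n * Real.log (k.a n) / n) ≤ k.C₀ * k.τ n
  growth_b : (k.B₁ n * k.τ n + (M.S n P).toReal * Real.log n / Real.sqrt n) ^ (k.ω / 2)
      * Real.sqrt (k.v n * Real.log (k.a n))
    + (n : ℝ) ^ (-(1 / 2) + 1 / k.q) * k.v n * k.K n * Real.log (k.a n) ≤ k.C₀ * k.δ n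
  growth_c : Real.sqrt n * k.B₁ n ^ 2 * k.B₂ n * k.τ n ^ 2 ≤ k.C₀ * k.δ n

/-- `θcheck_{uj} ∈ Θ_{uj}` are approximate `ε`-solutions of the sample analogs of the moment
conditions, with estimates `ηhat` plugged in for the nuisance parameters, at the data `w`. -/
def IsApproxZEstimate {𝒲 E : Type*} [MeasurableSpace 𝒲] [AddCommGroup E] [Module ℝ E]
    {d p n : ℕ} (M : MomentModel 𝒲 E d p) (ε : ℝ) (w : Fin n → 𝒲)
    (θcheck : M.U → Fin p → ℝ) (ηhat : M.U → Fin p → E) : Prop :=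
  ∀ u j, θcheck u j ∈ M.Θ u j ∧
    |empMean w (fun x => M.ψ u j x (θcheck u j) (ηhat u j))|
      - (⨅ θ : M.Θ u j, |empMean w (fun x => M.ψ u j x (θ : ℝ) (ηhat u j))|) ≤ ε

end

/-!
The estimator nearly solves the empirical moment condition `𝔼ₙ[ψ(W, θ, η̂)] = 0`, and the
representation comes from comparing that condition with its linearization
`𝔼ₙ[ψ(W, θ₀, η₀)] + J (θ - θ₀) = 0`. On the event that `η̂ ∈ 𝒯` three facts about the sample, each
of probability close to one, make the comparison deterministic (`bahadur_of_empMean_bounds`):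

* `|𝔼ₙ f - E_P f| = O(τₙ)` on `ℱ₁`, whence by the bound on the derivative in the direction of the
  nuisance parameter and by identifiability the preliminary rate `|θ̌ - θ₀| = O(B₁ₙ τₙ)`;
* `|(𝔼ₙ - E_P)(f - g)| = O(δₙ / √n)` for all members `f`, `g` of `ℱ₁` with `L²(P)`-distance
  `O((B₁ₙ τₙ)^(ω/2))`; with near-orthogonality and a second-order expansion along segments
  (`MomentConditions.abs_mean_sub_linear_le`) the empirical moment then differs from its
  linearization by `O(δₙ / √n)`, for all `θ` at distance `O(B₁ₙ τₙ)` from `θ₀`;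
* `|𝔼ₙ[ψ(W, θ₀, η₀)]| = O(𝒮ₙ / √n)`, so that the solution `θ₀ - J⁻¹ 𝔼ₙ[ψ(W, θ₀, η₀)]` of the
  linearized condition lies in `Θ`. There the empirical moment is `O(δₙ / √n)`; hence it is so at
  the near-minimizer `θ̌`, and expanding at `θ̌` yields the representation.

The third fact is Markov's inequality. The other two follow from the maximal inequality
`lintegral_iSup_empMean_sub_le_of_cover`: with `L` of the order of `v log a`,
`E sup |(𝔼ₙ - E_P) f| ≲ ρ (L / n)^(1/2) + L K n^(1/q - 1)` over a class of functions with
`E_P f² ≤ ρ²`. It is proved by symmetrization (`lintegral_iSup_empMean_sub_le`) and Massart's finite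
class lemma on a net of radius of order `1/n` relative to the envelope. Entropy numbers are
logarithmic in the radius, so that such a net is no larger, up to constants in the exponent, than
the ones at coarser scales, and no chaining is needed. The random variance `sup 𝔼ₙ f²` that Massart's
lemma produces is controlled by applying the same argument to the squares `f²`.

Suprema over the class are measurable up to null sets, since projections of measurable sets along
standard Borel spaces are (`MeasurableSet.nullMeasurableSet_image_fst`); this rests on Choquet's
capacitability theorem for analytic sets.
-/

/-! ### Universal measurability of analytic sets -/

/-- Inside an analytic set there are compact sets of almost the same outer measure. This is
Choquet's capacitability theorem in the case of a finite Borel measure. -/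
theorem MeasureTheory.AnalyticSet.exists_isCompact_measure_le {X : Type*} [TopologicalSpace X]
    [PolishSpace X] [MeasurableSpace X] [BorelSpace X] {s : Set X} (hs : AnalyticSet s)
    (ν : Measure X) [IsFiniteMeasure ν] {ε : ℝ≥0∞} (hε : ε ≠ 0) :
    ∃ K, IsCompact K ∧ K ⊆ s ∧ ν s ≤ ν K + ε := by
  rw [AnalyticSet] at hs
  rcases hs with rfl | ⟨f, hf, rfl⟩
  · exact ⟨∅, isCompact_empty, Subset.rfl, by simp⟩
  obtain ⟨e, he, hsum⟩ := ENNReal.exists_pos_sum_of_countable' hε ℕ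
  -- bounding one more coordinate costs at most `e m` in outer measure
  have step : ∀ (m : ℕ) (D : Set (ℕ → ℕ)), ∃ j, ν (f '' D) ≤ ν (f '' (D ∩ {s | s m ≤ j})) + e m := by
    intro m D
    have hmono : Monotone fun j : ℕ => f '' (D ∩ {s : ℕ → ℕ | s m ≤ j}) := by
      intro i j hij
      exact image_mono (inter_subset_inter_right _ fun s (hs : s m ≤ i) => hs.trans hij)
    have hU : ⋃ j : ℕ, f '' (D ∩ {s : ℕ → ℕ | s m ≤ j}) = f '' D := by
      rw [← image_iUnion, ← inter_iUnion]
      congr 1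
      refine inter_eq_left.2 fun s _ => mem_iUnion.2 ⟨s m, ?_⟩
      simp
    have h := hmono.measure_iUnion (μ := ν)
    rw [hU] at h
    rcases eq_or_ne (ν (f '' D)) 0 with h0 | h0
    · exact ⟨0, by simp [h0]⟩
    have hlt : ν (f '' D) - e m < ⨆ j : ℕ, ν (f '' (D ∩ {s : ℕ → ℕ | s m ≤ j})) := by
      rw [← h]
      exact ENNReal.sub_lt_self (measure_ne_top _ _) h0 (he m).ne'
    obtain ⟨j, hj⟩ := lt_iSup_iff.1 hlt
    exact ⟨j, tsub_le_iff_right.1 hj.le⟩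
  choose J hJ using step
  let D : ℕ → Set (ℕ → ℕ) := fun m => Nat.rec univ (fun m D => D ∩ {s | s m ≤ J m D}) m
  have hDs : ∀ m, D (m + 1) = D m ∩ {s | s m ≤ J m (D m)} := fun m => rfl
  let k : ℕ → ℕ := fun m => J m (D m)
  have hD : ∀ m, D m = {s | ∀ i < m, s i ≤ k i} := by
    intro m
    induction m with
    | zero => simp [D]
    | succ m ih =>
      rw [hDs]
      ext s
      simp only [mem_inter_iff, mem_ofPred_eq, Nat.lt_succ_iff_lt_or_eq]
      constructor
      · rintro ⟨h1, h2⟩ i (hi | rfl)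
        · rw [ih] at h1; exact h1 i hi
        · exact h2
      · intro h
        refine ⟨?_, h m (Or.inr rfl)⟩
        rw [ih]; exact fun i hi => h i (Or.inl hi)
  have hmeas : ∀ m, ν (range f) ≤ ν (f '' D m) + ∑ i ∈ Finset.range m, e i := by
    intro m
    induction m with
    | zero => simp [D, image_univ]
    | succ m ih =>
      refine ih.trans ?_
      rw [Finset.sum_range_succ, add_comm (∑ i ∈ Finset.range m, e i), ← add_assoc]
      gcongr
      exact hJ m (D m)
  let K₀ : Set (ℕ → ℕ) := pi univ fun i => Iic (k i)
  have hK₀ : IsCompact K₀ := isCompact_univ_pi fun i => (finite_Iic (k i)).isCompact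
  refine ⟨f '' K₀, hK₀.image hf, image_subset_range _ _, ?_⟩
  have key : ∀ U : Set X, IsOpen U → f '' K₀ ⊆ U → ∃ m, f '' D m ⊆ U := by
    intro U hU hKU
    have hV : IsOpen (f ⁻¹' U) := hU.preimage hf
    have hcyl : ∀ x ∈ K₀, ∃ m, PiNat.cylinder x m ⊆ f ⁻¹' U := by
      intro x hx
      have hxU : x ∈ f ⁻¹' U := hKU (mem_image_of_mem f hx)
      obtain ⟨t, ⟨y, m, rfl⟩, hxt, ht⟩ :=
        (PiNat.isTopologicalBasis_cylinders (fun _ => ℕ)).exists_subset_of_mem_open hxU hV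
      refine ⟨m, ?_⟩
      rwa [PiNat.mem_cylinder_iff_eq.1 hxt]
    choose! N hN using hcyl
    obtain ⟨t, htK, hcov⟩ := hK₀.elim_nhds_subcover (fun x => PiNat.cylinder x (N x))
      fun x _ => (PiNat.isOpen_cylinder _ x (N x)).mem_nhds (PiNat.self_mem_cylinder x _)
    refine ⟨t.sup N, ?_⟩
    rintro _ ⟨s, hs, rfl⟩
    rw [hD] at hs
    have hs' : (fun i => min (s i) (k i)) ∈ K₀ := fun i _ => mem_Iic.2 (min_le_right _ _)
    obtain ⟨x, hxt, hx⟩ := mem_iUnion₂.1 (hcov hs')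
    refine hN x (htK x hxt) ?_
    rw [PiNat.mem_cylinder_iff] at hx ⊢
    intro i hi
    rw [← hx i hi]
    exact (min_eq_left (hs i (hi.trans_le (Finset.le_sup hxt)))).symm
  have hle : ∀ U : Set X, f '' K₀ ⊆ U → IsOpen U → ν (range f) - ε ≤ ν U := by
    intro U hKU hU
    obtain ⟨m, hm⟩ := key U hU hKU
    refine tsub_le_iff_right.2 ((hmeas m).trans ?_)
    gcongr
    exact (ENNReal.sum_le_tsum _).trans hsum.le
  rw [← tsub_le_iff_right, (f '' K₀).measure_eq_iInf_isOpen]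
  exact le_iInf fun U => le_iInf fun h1 => le_iInf fun h2 => hle U h1 h2

/-- Analytic sets are universally measurable. -/
theorem MeasureTheory.AnalyticSet.nullMeasurableSet {X : Type*} [TopologicalSpace X]
    [PolishSpace X] [MeasurableSpace X] [BorelSpace X] {s : Set X} (hs : AnalyticSet s)
    (ν : Measure X) [IsFiniteMeasure ν] : NullMeasurableSet s ν := by
  have h : ∀ m : ℕ, ∃ K, IsCompact K ∧ K ⊆ s ∧ ν s ≤ ν K + ((m : ℝ≥0∞) + 1)⁻¹ := fun m =>
    hs.exists_isCompact_measure_le ν (ENNReal.inv_ne_zero.2 (by finiteness))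
  choose K hK hKs hν using h
  have hm : MeasurableSet (⋃ m, K m) := MeasurableSet.iUnion fun m => (hK m).measurableSet
  have hge : ν s ≤ ν (⋃ m, K m) := by
    refine ENNReal.le_of_forall_pos_le_add fun δ hδ _ => ?_
    obtain ⟨m, hm⟩ := ENNReal.exists_inv_nat_lt (a := (δ : ℝ≥0∞)) (by simpa using hδ.ne')
    refine (hν m).trans ?_
    gcongr
    · exact subset_iUnion K m
    · refine le_trans ?_ hm.le
      gcongr
      exact le_self_add
  have := ae_eq_of_subset_of_measure_ge (iUnion_subset hKs) hge hm.nullMeasurableSet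
    (measure_ne_top _ _)
  exact hm.nullMeasurableSet.congr this

/-- A measurable subset of a product `X × Y` depends on the first coordinate only through a map to
some standard Borel space. -/
theorem MeasurableSet.exists_preimage_standardBorel {X Y : Type*} [MeasurableSpace X]
    [MeasurableSpace Y] {A : Set (X × Y)} (hA : MeasurableSet A) :
    ∃ (C : Type) (_ : MeasurableSpace C) (_ : StandardBorelSpace C) (g : X → C)
      (B : Set (C × Y)), Measurable g ∧ MeasurableSet B ∧ A = Prod.map g id ⁻¹' B := by
  classical
  rw [← generateFrom_prod] at hA
  induction A, hA using MeasurableSpace.generateFrom_induction with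
  | hC t ht _ =>
    obtain ⟨s, hs, u, hu, rfl⟩ := ht
    refine ⟨Bool, inferInstance, inferInstance, fun x => decide (x ∈ s), {true} ×ˢ u,
      measurable_to_bool (by simpa [preimage] using hs), (measurableSet_singleton _).prod hu, ?_⟩
    ext ⟨x, y⟩
    simp
  | empty => exact ⟨Bool, inferInstance, inferInstance, fun _ => true, ∅, measurable_const,
      MeasurableSet.empty, by simp⟩
  | compl t _ ih =>
    obtain ⟨C, i1, i2, g, B, hg, hB, rfl⟩ := ih
    exact ⟨C, i1, i2, g, Bᶜ, hg, hB.compl, rfl⟩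
  | iUnion t _ ih =>
    choose C i1 i2 g B hg hB ht using ih
    refine ⟨∀ n, C n, inferInstance, inferInstance, fun x n => g n x,
      ⋃ n, (fun c : (∀ n, C n) × Y => (c.1 n, c.2)) ⁻¹' B n, measurable_pi_lambda _ hg,
      MeasurableSet.iUnion fun n => ?_, ?_⟩
    · exact (((measurable_pi_apply n).comp measurable_fst).prodMk measurable_snd) (hB n)
    · ext ⟨x, y⟩
      simp only [mem_iUnion, ht, mem_preimage, Prod.map_apply, id]

/-- Measurable projection theorem: the projection of a measurable set along a standard Borel factor
is measurable for the completion of every finite measure. -/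
theorem MeasurableSet.nullMeasurableSet_image_fst {X Y : Type*} [MeasurableSpace X]
    [MeasurableSpace Y] [StandardBorelSpace Y] {A : Set (X × Y)} (hA : MeasurableSet A)
    (μ : Measure X) [IsFiniteMeasure μ] : NullMeasurableSet (Prod.fst '' A) μ := by
  obtain ⟨C, i1, i2, g, B, hg, hB, rfl⟩ := hA.exists_preimage_standardBorel
  let _ := upgradeStandardBorel C
  have h := (hB.analyticSet_image measurable_fst).nullMeasurableSet (μ.map g)
  have e : Prod.fst '' (Prod.map g id ⁻¹' B) = g ⁻¹' (Prod.fst '' B) := by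
    ext x
    simp
  rw [e]
  exact h.preimage ⟨hg, Measure.AbsolutelyContinuous.rfl⟩

/-- A supremum of jointly measurable functions over a standard Borel parameter space is measurable
for the completion of every finite measure. -/
theorem Measurable.aemeasurable_iSup_standardBorel {X Y : Type*} [MeasurableSpace X]
    [MeasurableSpace Y] [StandardBorelSpace Y] {h : X × Y → ℝ≥0∞} (hh : Measurable h)
    (μ : Measure X) [IsFiniteMeasure μ] : AEMeasurable (fun x => ⨆ y, h (x, y)) μ := by
  refine NullMeasurable.aemeasurable ?_
  refine @measurable_of_Ioi ℝ≥0∞ (NullMeasurableSpace X μ) _ _ _ _ _ _ _ _ fun c => ?_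
  have e : (fun x => ⨆ y, h (x, y)) ⁻¹' Ioi c = Prod.fst '' (h ⁻¹' Ioi c) := by
    ext x
    simp [lt_iSup_iff]
  have h0 : NullMeasurableSet ((fun x => ⨆ y, h (x, y)) ⁻¹' Ioi c) μ := by
    rw [e]
    exact (hh measurableSet_Ioi).nullMeasurableSet_image_fst μ
  exact h0

/-! ### Rademacher averages and symmetrization -/

/-- The sign `±1` encoded by a Boolean. -/
def boolSign (b : Bool) : ℝ := bif b then 1 else -1

theorem abs_boolSign (b : Bool) : |boolSign b| = 1 := by cases b <;> simp [boolSign]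

/-- The average over all sign vectors `ε ∈ {-1, 1}ⁿ` of `exp(∑ εᵢ bᵢ)` is `∏ cosh bᵢ`, which is at
most `exp(∑ bᵢ² / 2)`. -/
theorem sum_exp_sum_boolSign_le {n : ℕ} (b : Fin n → ℝ) :
    ∑ e : Fin n → Bool, Real.exp (∑ i, boolSign (e i) * b i)
      ≤ 2 ^ n * Real.exp ((∑ i, b i ^ 2) / 2) := by
  have h1 : ∑ e : Fin n → Bool, Real.exp (∑ i, boolSign (e i) * b i)
      = ∏ i, ∑ c : Bool, Real.exp (boolSign c * b i) := by
    simp_rw [Real.exp_sum]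
    rw [Finset.prod_univ_sum, Fintype.piFinset_univ]
  have h2 : ∀ i, ∑ c : Bool, Real.exp (boolSign c * b i) = 2 * Real.cosh (b i) := by
    intro i
    simp [boolSign, Real.cosh_eq]
    ring
  simp_rw [h1, h2, Finset.prod_mul_distrib, Finset.sum_div, Real.exp_sum]
  simp only [Finset.prod_const, Finset.card_univ, Fintype.card_fin]
  gcongr with i
  · exact Real.cosh_le_exp_half_sq _

/-- Massart's finite class lemma for Rademacher averages, before optimizing over the parameter `l`
of the exponential moment. -/
theorem average_boolSign_le {κ : Type*} {n : ℕ} (t : Finset κ) (b : κ → Fin n → ℝ) {s L l : ℝ}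
    (hs : ∀ k ∈ t, ∑ i, b k i ^ 2 ≤ s) (hL : 2 * (t.card : ℝ) ≤ Real.exp L) (hl : 0 < l)
    (m : (Fin n → Bool) → ℝ) (hm : ∀ e, ∃ k ∈ t, m e ≤ |∑ i, boolSign (e i) * b k i|) :
    ((2 : ℝ) ^ n)⁻¹ * ∑ e, m e ≤ L / l + l * s / 2 := by
  set A := L + l ^ 2 * s / 2 with hA
  have hexp : ∀ e, Real.exp (l * m e) ≤ ∑ k ∈ t,
      (Real.exp (∑ i, boolSign (e i) * (l * b k i)) +
        Real.exp (∑ i, boolSign (e i) * (-l * b k i))) := by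
    intro e
    obtain ⟨k, hk, hmk⟩ := hm e
    refine le_trans ?_ (Finset.single_le_sum (f := fun k =>
      Real.exp (∑ i, boolSign (e i) * (l * b k i)) +
        Real.exp (∑ i, boolSign (e i) * (-l * b k i))) (fun k _ => by positivity) hk)
    have e1 : ∑ i, boolSign (e i) * (l * b k i) = l * ∑ i, boolSign (e i) * b k i := by
      rw [Finset.mul_sum]; exact Finset.sum_congr rfl fun i _ => by ring
    have e2 : ∑ i, boolSign (e i) * (-l * b k i) = -(l * ∑ i, boolSign (e i) * b k i) := by
      rw [Finset.mul_sum, ← Finset.sum_neg_distrib]; exact Finset.sum_congr rfl fun i _ => by ring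
    simp only [e1, e2]
    set x := ∑ i, boolSign (e i) * b k i
    have h1 : Real.exp (l * m e) ≤ Real.exp (l * |x|) := by gcongr
    rcases abs_cases x with ⟨hx, _⟩ | ⟨hx, _⟩
    · rw [hx] at h1
      linarith [Real.exp_pos (-(l * x))]
    · rw [hx, mul_neg] at h1
      linarith [Real.exp_pos (l * x)]
  have hmgf : ∀ c : ℝ, c ^ 2 = l ^ 2 → ∀ k ∈ t,
      ∑ e : Fin n → Bool, Real.exp (∑ i, boolSign (e i) * (c * b k i))
        ≤ 2 ^ n * Real.exp (l ^ 2 * s / 2) := by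
    intro c hc k hk
    refine (sum_exp_sum_boolSign_le _).trans ?_
    have h3 : (∑ i, (c * b k i) ^ 2) / 2 ≤ l ^ 2 * s / 2 := by
      simp_rw [mul_pow, hc, ← Finset.mul_sum]
      have := mul_le_mul_of_nonneg_left (hs k hk) (sq_nonneg l)
      linarith
    exact mul_le_mul_of_nonneg_left (Real.exp_le_exp.2 h3) (by positivity)
  have hsum : ∑ e, Real.exp (l * m e) ≤ 2 ^ n * Real.exp A := by
    calc ∑ e, Real.exp (l * m e)
        ≤ ∑ e : Fin n → Bool, ∑ k ∈ t, (Real.exp (∑ i, boolSign (e i) * (l * b k i)) +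
            Real.exp (∑ i, boolSign (e i) * (-l * b k i))) := by
          exact Finset.sum_le_sum fun e _ => hexp e
      _ = ∑ k ∈ t, ((∑ e : Fin n → Bool, Real.exp (∑ i, boolSign (e i) * (l * b k i))) +
            ∑ e : Fin n → Bool, Real.exp (∑ i, boolSign (e i) * (-l * b k i))) := by
          rw [Finset.sum_comm]
          simp_rw [Finset.sum_add_distrib]
      _ ≤ ∑ k ∈ t, (2 ^ n * Real.exp (l ^ 2 * s / 2) + 2 ^ n * Real.exp (l ^ 2 * s / 2)) := by
          refine Finset.sum_le_sum fun k hk => ?_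
          exact add_le_add (hmgf l rfl k hk) (hmgf (-l) (by ring) k hk)
      _ = 2 ^ n * ((2 * t.card) * Real.exp (l ^ 2 * s / 2)) := by
          rw [Finset.sum_const, nsmul_eq_mul]; ring
      _ ≤ 2 ^ n * (Real.exp L * Real.exp (l ^ 2 * s / 2)) := by gcongr
      _ = 2 ^ n * Real.exp A := by rw [hA, Real.exp_add]
  -- linearizing the exponential at `A` takes the place of Jensen's inequality
  have hlin : ∀ e, l * m e ≤ A - 1 + Real.exp (-A) * Real.exp (l * m e) := by
    intro e
    have := Real.add_one_le_exp (l * m e - A)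
    rw [sub_eq_add_neg, add_comm (l * m e), Real.exp_add] at this
    linarith
  have htot : l * ∑ e, m e ≤ 2 ^ n * A := by
    rw [Finset.mul_sum]
    calc ∑ e, l * m e ≤ ∑ e, (A - 1 + Real.exp (-A) * Real.exp (l * m e)) :=
          Finset.sum_le_sum fun e _ => hlin e
      _ = 2 ^ n * (A - 1) + Real.exp (-A) * ∑ e, Real.exp (l * m e) := by
          rw [Finset.sum_add_distrib, ← Finset.mul_sum]
          simp
          ring
      _ ≤ 2 ^ n * (A - 1) + Real.exp (-A) * (2 ^ n * Real.exp A) := by gcongr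
      _ = 2 ^ n * A := by
          rw [mul_left_comm, ← Real.exp_add, neg_add_cancel, Real.exp_zero]; ring
  have hp : (0 : ℝ) < 2 ^ n := by positivity
  rw [inv_mul_le_iff₀ hp]
  have : L / l + l * s / 2 = A / l := by rw [hA]; field_simp
  rw [this, ← mul_div_assoc, le_div_iff₀ hl]
  linarith

/-- Rademacher averages over a set of vectors which has a finite `ℓ¹`-net. -/
theorem average_iSup_boolSign_le {Z : Type*} {n : ℕ} (A : Z → Fin n → ℝ) (t : Finset Z)
    {r s L l : ℝ} (hr : 0 ≤ r) (hnet : ∀ z, ∃ z' ∈ t, ∑ i, |A z i - A z' i| ≤ r)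
    (hs : ∀ z ∈ t, ∑ i, A z i ^ 2 ≤ s) (hL : 2 * (t.card : ℝ) ≤ Real.exp L) (hl : 0 < l) :
    ((2 : ℝ≥0∞) ^ n)⁻¹ * ∑ e : Fin n → Bool, ⨆ z, ‖(n : ℝ)⁻¹ * ∑ i, boolSign (e i) * A z i‖ₑ
      ≤ ENNReal.ofReal ((n : ℝ)⁻¹ * (L / l + l * s / 2 + r)) := by
  rcases isEmpty_or_nonempty Z with hZ | ⟨⟨z₀⟩⟩
  · simp
  obtain ⟨k₀, hk₀, -⟩ := hnet z₀
  have hmax : ∀ e : Fin n → Bool, ∃ k ∈ t, ∀ k' ∈ t,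
      |∑ i, boolSign (e i) * A k' i| ≤ |∑ i, boolSign (e i) * A k i| := fun e =>
    Finset.exists_max_image t (fun k => |∑ i, boolSign (e i) * A k i|) ⟨k₀, hk₀⟩
  choose k hk hkmax using hmax
  have hav := average_boolSign_le t A hs hL hl (fun e => |∑ i, boolSign (e i) * A (k e) i|)
    fun e => ⟨k e, hk e, le_rfl⟩
  have hsup : ∀ e : Fin n → Bool, ⨆ z, ‖(n : ℝ)⁻¹ * ∑ i, boolSign (e i) * A z i‖ₑ
      ≤ ENNReal.ofReal ((n : ℝ)⁻¹ * (|∑ i, boolSign (e i) * A (k e) i| + r)) := by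
    intro e
    refine iSup_le fun z => ?_
    rw [Real.enorm_eq_ofReal_abs]
    refine ENNReal.ofReal_le_ofReal ?_
    rw [abs_mul, abs_of_nonneg (by positivity : (0 : ℝ) ≤ (n : ℝ)⁻¹)]
    gcongr
    obtain ⟨z', hz', hd⟩ := hnet z
    have e1 : ∑ i, boolSign (e i) * A z i = ∑ i, boolSign (e i) * A z' i
        + ∑ i, boolSign (e i) * (A z i - A z' i) := by
      rw [← Finset.sum_add_distrib]; exact Finset.sum_congr rfl fun i _ => by ring
    rw [e1]
    refine (abs_add_le _ _).trans (add_le_add (hkmax e z' hz') ?_)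
    refine (Finset.abs_sum_le_sum_abs _ _).trans (le_trans (le_of_eq ?_) hd)
    exact Finset.sum_congr rfl fun i _ => by rw [abs_mul, abs_boolSign, one_mul]
  calc ((2 : ℝ≥0∞) ^ n)⁻¹ * ∑ e : Fin n → Bool, ⨆ z, ‖(n : ℝ)⁻¹ * ∑ i, boolSign (e i) * A z i‖ₑ
      ≤ ((2 : ℝ≥0∞) ^ n)⁻¹ * ∑ e : Fin n → Bool,
          ENNReal.ofReal ((n : ℝ)⁻¹ * (|∑ i, boolSign (e i) * A (k e) i| + r)) := by
        gcongr with e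
        exact hsup e
    _ = ENNReal.ofReal (((2 : ℝ) ^ n)⁻¹ * ∑ e : Fin n → Bool,
          ((n : ℝ)⁻¹ * (|∑ i, boolSign (e i) * A (k e) i| + r))) := by
        rw [← ENNReal.ofReal_sum_of_nonneg fun e _ => by positivity,
          ENNReal.ofReal_mul (by positivity), ENNReal.ofReal_inv_of_pos (by positivity),
          ENNReal.ofReal_pow (by norm_num)]
        simp
    _ ≤ _ := by
        refine ENNReal.ofReal_le_ofReal ?_
        rw [← Finset.mul_sum, Finset.sum_add_distrib, mul_left_comm, mul_add]
        gcongr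
        simp

/-- The sample obtained from a pair of samples by choosing the `i`-th observation from the first
sample if `e i` is true, and from the second one otherwise; together with the sample of the
observations not chosen. -/
def swapSamples {𝒲 : Type*} {n : ℕ} (e : Fin n → Bool) (x : (Fin n → 𝒲) × (Fin n → 𝒲)) :
    (Fin n → 𝒲) × (Fin n → 𝒲) :=
  (fun i => bif e i then x.1 i else x.2 i, fun i => bif e i then x.2 i else x.1 i)

theorem measurePreserving_swapSamples {𝒲 : Type*} [MeasurableSpace 𝒲] (P : Measure 𝒲)
    [IsProbabilityMeasure P] {n : ℕ} (e : Fin n → Bool) :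
    MeasurePreserving (swapSamples e)
      ((Measure.pi fun _ : Fin n => P).prod (Measure.pi fun _ : Fin n => P))
      ((Measure.pi fun _ : Fin n => P).prod (Measure.pi fun _ : Fin n => P)) := by
  have h1 := measurePreserving_arrowProdEquivProdArrow 𝒲 𝒲 (Fin n) (fun _ => P) (fun _ => P)
  have h2 : MeasurePreserving (fun (a : Fin n → 𝒲 × 𝒲) i => (bif e i then id else Prod.swap) (a i))
      (Measure.pi fun _ : Fin n => P.prod P) (Measure.pi fun _ : Fin n => P.prod P) := by
    refine measurePreserving_pi _ _ fun i => ?_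
    cases e i
    · exact Measure.measurePreserving_swap
    · exact MeasurePreserving.id _
  have h3 := (h1.comp h2).comp h1.symm
  convert h3 using 1
  ext x i
  · cases h : e i <;>
      simp [swapSamples, MeasurableEquiv.arrowProdEquivProdArrow, Equiv.arrowProdEquivProdArrow, h]
  · cases h : e i <;>
      simp [swapSamples, MeasurableEquiv.arrowProdEquivProdArrow, Equiv.arrowProdEquivProdArrow, h]

theorem integral_empMean {𝒲 : Type*} [MeasurableSpace 𝒲] (P : Measure 𝒲)
    [IsProbabilityMeasure P] {n : ℕ} (hn : n ≠ 0) {f : 𝒲 → ℝ} (hf : Integrable f P) :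
    Integrable (fun x : Fin n → 𝒲 => empMean x f) (Measure.pi fun _ => P) ∧
      ∫ x : Fin n → 𝒲, empMean x f ∂(Measure.pi fun _ => P) = ∫ w, f w ∂P := by
  have hi : ∀ i : Fin n, Integrable (fun x : Fin n → 𝒲 => f (x i)) (Measure.pi fun _ => P) :=
    fun i => integrable_comp_eval (μ := fun _ : Fin n => P) hf
  refine ⟨(integrable_finsetSum _ fun i _ => hi i).const_mul _, ?_⟩
  unfold empMean
  rw [integral_const_mul, integral_finsetSum _ fun i _ => hi i]
  have : ∀ i : Fin n, ∫ x : Fin n → 𝒲, f (x i) ∂(Measure.pi fun _ => P) = ∫ w, f w ∂P :=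
    fun i => integral_comp_eval (μ := fun _ : Fin n => P) hf.aestronglyMeasurable
  simp_rw [this]
  simp [hn]

theorem measurable_apply_of_jointly {𝒲 Z α : Type*} [MeasurableSpace 𝒲] [MeasurableSpace Z]
    [MeasurableSpace α] {H : Z → 𝒲 → ℝ} (hH : Measurable fun x : 𝒲 × Z => H x.2 x.1)
    {f : α → 𝒲} {g : α → Z} (hf : Measurable f) (hg : Measurable g) :
    Measurable fun a => H (g a) (f a) :=
  hH.comp (hf.prodMk hg)

/-- Symmetrization: the expected supremum of the centred empirical means is at most twice the
expectation of any bound on the Rademacher averages. -/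
theorem lintegral_iSup_empMean_sub_le {𝒲 Z : Type*} [MeasurableSpace 𝒲] [MeasurableSpace Z]
    [StandardBorelSpace Z] (P : Measure 𝒲) [IsProbabilityMeasure P] {n : ℕ} (hn : n ≠ 0)
    (H : Z → 𝒲 → ℝ) (hH : Measurable fun x : 𝒲 × Z => H x.2 x.1) (hint : ∀ z, Integrable (H z) P)
    (Φ : (Fin n → 𝒲) → ℝ≥0∞) (hΦ : AEMeasurable Φ (Measure.pi fun _ => P))
    (hR : ∀ x : Fin n → 𝒲, ((2 : ℝ≥0∞) ^ n)⁻¹ *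
      ∑ e : Fin n → Bool, ⨆ z, ‖(n : ℝ)⁻¹ * ∑ i, boolSign (e i) * H z (x i)‖ₑ ≤ Φ x) :
    ∫⁻ x : Fin n → 𝒲, ⨆ z, ‖empMean x (H z) - ∫ w, H z w ∂P‖ₑ ∂(Measure.pi fun _ => P)
      ≤ 2 * ∫⁻ x, Φ x ∂(Measure.pi fun _ => P) := by
  set ν : Measure (Fin n → 𝒲) := Measure.pi fun _ => P
  let S : (Fin n → 𝒲) × (Fin n → 𝒲) → ℝ≥0∞ := fun x =>
    ⨆ z, ‖empMean x.1 (H z) - empMean x.2 (H z)‖ₑ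
  have hSm : AEMeasurable S (ν.prod ν) := by
    refine Measurable.aemeasurable_iSup_standardBorel (h := fun y : ((Fin n → 𝒲) × (Fin n → 𝒲)) × Z
      => ‖empMean y.1.1 (H y.2) - empMean y.1.2 (H y.2)‖ₑ) ?_ _
    refine Measurable.enorm (Measurable.sub
      (Measurable.const_mul (Finset.measurable_sum _ fun i _ => ?_) _)
      (Measurable.const_mul (Finset.measurable_sum _ fun i _ => ?_) _))
    · exact measurable_apply_of_jointly hH ((measurable_pi_apply i).comp
        (measurable_fst.comp measurable_fst)) measurable_snd
    · exact measurable_apply_of_jointly hH ((measurable_pi_apply i).comp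
        (measurable_snd.comp measurable_fst)) measurable_snd
  have h1 : ∀ x : Fin n → 𝒲, ⨆ z, ‖empMean x (H z) - ∫ w, H z w ∂P‖ₑ ≤ ∫⁻ x', S (x, x') ∂ν := by
    intro x
    refine iSup_le fun z => ?_
    obtain ⟨hi, he⟩ := integral_empMean P hn (hint z)
    have e1 : empMean x (H z) - ∫ w, H z w ∂P
        = ∫ x' : Fin n → 𝒲, (empMean x (H z) - empMean x' (H z)) ∂ν := by
      rw [integral_sub (integrable_const _) hi, he]
      simp
    rw [e1]
    refine (enorm_integral_le_lintegral_enorm _).trans (lintegral_mono fun x' => ?_)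
    exact le_iSup (fun z => ‖empMean x (H z) - empMean x' (H z)‖ₑ) z
  let R : (Fin n → Bool) → (Fin n → 𝒲) → ℝ≥0∞ := fun e x =>
    ⨆ z, ‖(n : ℝ)⁻¹ * ∑ i, boolSign (e i) * H z (x i)‖ₑ
  have h2 : ∀ e x, S (swapSamples e x) ≤ R e x.1 + R e x.2 := by
    intro e x
    refine iSup_le fun z => ?_
    have e1 : empMean (swapSamples e x).1 (H z) - empMean (swapSamples e x).2 (H z)
        = (n : ℝ)⁻¹ * ∑ i, boolSign (e i) * H z (x.1 i)
          - (n : ℝ)⁻¹ * ∑ i, boolSign (e i) * H z (x.2 i) := by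
      unfold empMean
      rw [← mul_sub, ← mul_sub, ← Finset.sum_sub_distrib, ← Finset.sum_sub_distrib]
      congr 1
      refine Finset.sum_congr rfl fun i _ => ?_
      cases h : e i <;> simp [swapSamples, boolSign, h, sub_eq_add_neg, add_comm]
    rw [e1]
    refine (enorm_sub_le).trans (add_le_add ?_ ?_)
    · exact le_iSup (fun z => ‖(n : ℝ)⁻¹ * ∑ i, boolSign (e i) * H z (x.1 i)‖ₑ) z
    · exact le_iSup (fun z => ‖(n : ℝ)⁻¹ * ∑ i, boolSign (e i) * H z (x.2 i)‖ₑ) z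
  have h3 : ∀ e : Fin n → Bool, ∫⁻ x, S (swapSamples e x) ∂(ν.prod ν) = ∫⁻ x, S x ∂(ν.prod ν) := by
    intro e
    have hp := measurePreserving_swapSamples P e
    have hS' : AEMeasurable S (Measure.map (swapSamples e) (ν.prod ν)) := by
      rw [hp.map_eq]; exact hSm
    rw [← lintegral_map' hS' hp.measurable.aemeasurable, hp.map_eq]
  have hSe : ∀ e : Fin n → Bool, AEMeasurable (fun x => S (swapSamples e x)) (ν.prod ν) :=
    fun e => hSm.comp_quasiMeasurePreserving 
      (measurePreserving_swapSamples P e).quasiMeasurePreserving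
  have hcard : ((2 : ℝ≥0∞) ^ n)⁻¹ * ((2 : ℝ≥0∞) ^ n) = 1 :=
    ENNReal.inv_mul_cancel (by positivity) (by finiteness)
  calc ∫⁻ x : Fin n → 𝒲, ⨆ z, ‖empMean x (H z) - ∫ w, H z w ∂P‖ₑ ∂ν
      ≤ ∫⁻ x, ∫⁻ x', S (x, x') ∂ν ∂ν := lintegral_mono h1
    _ = ∫⁻ x, S x ∂(ν.prod ν) := (lintegral_prod _ hSm).symm
    _ = ((2 : ℝ≥0∞) ^ n)⁻¹ * ∑ e : Fin n → Bool, ∫⁻ x, S (swapSamples e x) ∂(ν.prod ν) := by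
        simp_rw [h3]
        rw [Finset.sum_const, nsmul_eq_mul, ← mul_assoc]
        simp [hcard]
    _ = ∫⁻ x, ((2 : ℝ≥0∞) ^ n)⁻¹ * ∑ e : Fin n → Bool, S (swapSamples e x) ∂(ν.prod ν) := by
        rw [lintegral_const_mul' _ _ (by finiteness), lintegral_finsetSum' _ fun e _ => hSe e]
    _ ≤ ∫⁻ x, (Φ x.1 + Φ x.2) ∂(ν.prod ν) := by
        refine lintegral_mono fun x => ?_
        calc ((2 : ℝ≥0∞) ^ n)⁻¹ * ∑ e : Fin n → Bool, S (swapSamples e x)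
            ≤ ((2 : ℝ≥0∞) ^ n)⁻¹ * ∑ e : Fin n → Bool, (R e x.1 + R e x.2) := by
              gcongr with e
              exact h2 e x
          _ = ((2 : ℝ≥0∞) ^ n)⁻¹ * ∑ e : Fin n → Bool, R e x.1
              + ((2 : ℝ≥0∞) ^ n)⁻¹ * ∑ e : Fin n → Bool, R e x.2 := by
              rw [Finset.sum_add_distrib, mul_add]
          _ ≤ Φ x.1 + Φ x.2 := add_le_add (hR _) (hR _)
    _ = 2 * ∫⁻ x, Φ x ∂ν := by
        have m1 := measurePreserving_fst (μ := ν) (ν := ν)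
        have m2 := measurePreserving_snd (μ := ν) (ν := ν)
        have hΦ1 : AEMeasurable (fun x : (Fin n → 𝒲) × (Fin n → 𝒲) => Φ x.1) (ν.prod ν) :=
          hΦ.comp_quasiMeasurePreserving m1.quasiMeasurePreserving
        rw [lintegral_add_left' hΦ1, two_mul]
        congr 1
        · rw [← lintegral_map' (by rw [m1.map_eq]; exact hΦ) measurable_fst.aemeasurable, m1.map_eq]
        · rw [← lintegral_map' (by rw [m2.map_eq]; exact hΦ) measurable_snd.aemeasurable, m2.map_eq]

/-! ### The maximal inequality -/

/-- If `Fᵢ ≥ 0` and `t > 0`, then `t² + t^(2-q) ∑ Fᵢ^q` bounds all `Fᵢ²`, since `F² ≤ t^(2-q) F^q`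
whenever `F ≥ t`. -/
theorem sq_le_sq_add_sum_rpow {n : ℕ} {q t : ℝ} (hq : 2 ≤ q) (ht : 0 < t) (f : Fin n → ℝ)
    (hf : ∀ i, 0 ≤ f i) (i : Fin n) : f i ^ 2 ≤ t ^ 2 + t ^ (2 - q) * ∑ j, f j ^ q := by
  have h0 : ∀ j, 0 ≤ f j ^ q := fun j => Real.rpow_nonneg (hf j) q
  have ht' : 0 < t ^ (2 - q) := Real.rpow_pos_of_pos ht _
  have h1 : f i ^ q ≤ ∑ j, f j ^ q :=
    Finset.single_le_sum (f := fun j => f j ^ q) (fun j _ => h0 j) (Finset.mem_univ i)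
  rcases le_or_gt (f i) t with h | h
  · have : f i ^ 2 ≤ t ^ 2 := pow_le_pow_left₀ (hf i) h 2
    have : 0 ≤ t ^ (2 - q) * ∑ j, f j ^ q := mul_nonneg ht'.le (Finset.sum_nonneg fun j _ => h0 j)
    linarith
  · have hfi : 0 < f i := ht.trans h
    have e : f i ^ 2 = f i ^ (2 - q) * f i ^ q := by
      rw [← Real.rpow_add hfi, sub_add_cancel, Real.rpow_two]
    have h2 : f i ^ (2 - q) ≤ t ^ (2 - q) :=
      Real.rpow_le_rpow_of_nonpos ht h.le (by linarith)
    calc f i ^ 2 = f i ^ (2 - q) * f i ^ q := e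
      _ ≤ t ^ (2 - q) * ∑ j, f j ^ q := by gcongr
      _ ≤ _ := by linarith [sq_nonneg t]

/-- With `t = n^(1/q) K`, the truncation bound for `max F(Xᵢ)²` has expectation at most `2 t²`. -/
theorem lintegral_sq_add_sum_rpow_le {𝒲 : Type*} [MeasurableSpace 𝒲] (P : Measure 𝒲)
    [IsProbabilityMeasure P] {n : ℕ} (hn : n ≠ 0) {q K : ℝ} (hq : 2 ≤ q) (hK : 0 < K)
    {F : 𝒲 → ℝ} (hFm : Measurable F) (hF0 : ∀ w, 0 ≤ F w)
    (hFK : eLpNorm F (ENNReal.ofReal q) P ≤ ENNReal.ofReal K) :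
    ∫⁻ x : Fin n → 𝒲, ENNReal.ofReal (((n : ℝ) ^ (1 / q) * K) ^ 2
      + ((n : ℝ) ^ (1 / q) * K) ^ (2 - q) * ∑ j, F (x j) ^ q) ∂(Measure.pi fun _ => P)
      ≤ ENNReal.ofReal (2 * ((n : ℝ) ^ (1 / q) * K) ^ 2) := by
  have hq0 : 0 < q := by linarith
  have hn' : (0 : ℝ) < n := by positivity
  set t := (n : ℝ) ^ (1 / q) * K with ht
  have htpos : 0 < t := by positivity
  have hFq : ∫⁻ w, ENNReal.ofReal (F w ^ q) ∂P ≤ ENNReal.ofReal (K ^ q) := by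
    have h := eLpNorm_eq_lintegral_rpow_enorm_toReal (μ := P) (f := F) (p := ENNReal.ofReal q)
      (by simpa using hq0) ENNReal.ofReal_ne_top
    rw [ENNReal.toReal_ofReal hq0.le] at h
    rw [h, one_div, ENNReal.rpow_inv_le_iff hq0, ENNReal.ofReal_rpow_of_pos hK] at hFK
    refine le_trans (le_of_eq ?_) hFK
    refine lintegral_congr fun w => ?_
    rw [Real.enorm_eq_ofReal (hF0 w), ENNReal.ofReal_rpow_of_nonneg (hF0 w) hq0.le]
  have hrp : ∀ w, 0 ≤ F w ^ q := fun w => Real.rpow_nonneg (hF0 w) q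
  have ht' : 0 ≤ t ^ (2 - q) := Real.rpow_nonneg htpos.le _
  have hm : Measurable fun w => ENNReal.ofReal (F w ^ q) := (hFm.pow_const q).ennreal_ofReal
  have e1 : ∀ x : Fin n → 𝒲, ENNReal.ofReal (t ^ 2 + t ^ (2 - q) * ∑ j, F (x j) ^ q)
      = ENNReal.ofReal (t ^ 2) + ENNReal.ofReal (t ^ (2 - q)) * ∑ j, ENNReal.ofReal (F (x j) ^ q) := by
    intro x
    rw [ENNReal.ofReal_add (by positivity)
      (mul_nonneg ht' (Finset.sum_nonneg fun j _ => hrp _)), ENNReal.ofReal_mul ht',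
      ENNReal.ofReal_sum_of_nonneg fun j _ => hrp _]
  simp_rw [e1]
  have hmj : ∀ j : Fin n, Measurable fun x : Fin n → 𝒲 => ENNReal.ofReal (F (x j) ^ q) :=
    fun j => hm.comp (measurable_pi_apply j)
  rw [lintegral_add_left measurable_const, lintegral_const_mul _
    (Finset.measurable_sum _ fun j _ => hmj j), lintegral_finsetSum _ fun j _ => hmj j]
  have e2 : ∀ j : Fin n, ∫⁻ x : Fin n → 𝒲, ENNReal.ofReal (F (x j) ^ q) ∂(Measure.pi fun _ => P)
      = ∫⁻ w, ENNReal.ofReal (F w ^ q) ∂P := fun j =>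
    (measurePreserving_eval (fun _ : Fin n => P) j).lintegral_comp hm
  simp_rw [e2]
  rw [Finset.sum_const, Finset.card_univ, Fintype.card_fin, nsmul_eq_mul, lintegral_const,
    measure_univ, mul_one]
  have e3 : t ^ (2 - q) * (n * K ^ q) = t ^ 2 := by
    have : (n : ℝ) * K ^ q = t ^ q := by
      rw [ht, Real.mul_rpow (by positivity) hK.le, ← Real.rpow_mul hn'.le, one_div_mul_cancel hq0.ne',
        Real.rpow_one]
    rw [this, ← Real.rpow_add htpos, sub_add_cancel, Real.rpow_two]
  calc _ ≤ ENNReal.ofReal (t ^ 2) + ENNReal.ofReal (t ^ (2 - q)) * (n * ENNReal.ofReal (K ^ q)) := by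
        gcongr
    _ = ENNReal.ofReal (t ^ 2 + t ^ (2 - q) * (n * K ^ q)) := by
        rw [ENNReal.ofReal_add (by positivity) (by positivity), ENNReal.ofReal_mul ht',
          ENNReal.ofReal_mul (by positivity), ENNReal.ofReal_natCast]
    _ = _ := by rw [e3, two_mul]

/-- Maximal inequality. The covering property says that, at every sample, the class `G` has an
internal net of radius `2/n`, relative to the empirical `L²`-norm of the envelope, with at most
`exp L / 2` elements. A net of such a small radius leaves an approximation error which is already
negligible, so that no chaining is needed. -/
theorem lintegral_iSup_empMean_sub_le_of_cover {𝒲 Z : Type*} [MeasurableSpace 𝒲]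
    [MeasurableSpace Z] [StandardBorelSpace Z] (P : Measure 𝒲) [IsProbabilityMeasure P] {n : ℕ}
    (hn : n ≠ 0) {q K ρ L : ℝ} (hq : 2 ≤ q) (hK : 0 < K) (hρ : 0 ≤ ρ) (hL : 1 ≤ L)
    (G : Z → 𝒲 → ℝ) (hG : Measurable fun x : 𝒲 × Z => G x.2 x.1)
    {F : 𝒲 → ℝ} (hFm : Measurable F) (hF0 : ∀ w, 0 ≤ F w) (hGF : ∀ z w, |G z w| ≤ F w)
    (hFK : eLpNorm F (ENNReal.ofReal q) P ≤ ENNReal.ofReal K)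
    (hGρ : ∀ z, ∫ w, G z w ^ 2 ∂P ≤ ρ ^ 2)
    (hcov : ∀ x : Fin n → 𝒲, ∃ t : Finset Z, 2 * (t.card : ℝ) ≤ Real.exp L ∧ ∀ z, ∃ z' ∈ t,
      ∑ i, (G z (x i) - G z' (x i)) ^ 2 ≤ (2 / n) ^ 2 * ∑ i, F (x i) ^ 2) :
    ∫⁻ x : Fin n → 𝒲, ⨆ z, ‖empMean x (G z) - ∫ w, G z w ∂P‖ₑ ∂(Measure.pi fun _ => P)
      ≤ ENNReal.ofReal (34 * (ρ * Real.sqrt (L / n) + L * K * (n : ℝ) ^ (1 / q) / n)) := by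
  have hq0 : 0 < q := by linarith
  have hn' : (0 : ℝ) < n := by positivity
  have hL0 : 0 < L := by linarith
  set ν : Measure (Fin n → 𝒲) := Measure.pi fun _ => P
  set t := (n : ℝ) ^ (1 / q) * K with ht
  have htpos : 0 < t := by positivity
  let D : (Fin n → 𝒲) → ℝ := fun x => t ^ 2 + t ^ (2 - q) * ∑ j, F (x j) ^ q
  have hDF : ∀ x i, F (x i) ^ 2 ≤ D x := fun x i =>
    sq_le_sq_add_sum_rpow hq htpos (fun i => F (x i)) (fun i => hF0 _) i
  have hDt : ∀ x, t ^ 2 ≤ D x := fun x => le_add_of_nonneg_right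
    (mul_nonneg (Real.rpow_nonneg htpos.le _)
      (Finset.sum_nonneg fun j _ => Real.rpow_nonneg (hF0 _) _))
  have hDpos : ∀ x, 0 < D x := fun x => (by positivity : 0 < t ^ 2).trans_le (hDt x)
  have hDm : Measurable D := by
    refine measurable_const.add (Measurable.const_mul (Finset.measurable_sum _ fun j _ => ?_) _)
    exact (hFm.comp (measurable_pi_apply j)).pow_const q
  have hDint : ∫⁻ x, ENNReal.ofReal (D x) ∂ν ≤ ENNReal.ofReal (2 * t ^ 2) :=
    lintegral_sq_add_sum_rpow_le P hn hq hK hFm hF0 hFK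
  have hFsum : ∀ x : Fin n → 𝒲, ∑ i, F (x i) ^ 2 ≤ n * D x := by
    intro x
    refine (Finset.sum_le_sum fun i _ => hDF x i).trans ?_
    simp
  have hGsq : ∀ z w, G z w ^ 2 ≤ F w ^ 2 := fun z w => sq_le_sq' (abs_le.1 (hGF z w)).1
    (abs_le.1 (hGF z w)).2
  have hGm : ∀ z, Measurable (G z) := fun z =>
    measurable_apply_of_jointly hG measurable_id measurable_const
  have hFL2 : MemLp F 2 P := by
    have : MemLp F (ENNReal.ofReal q) P :=
      ⟨hFm.aestronglyMeasurable, hFK.trans_lt ENNReal.ofReal_lt_top⟩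
    exact this.mono_exponent (by simpa using ENNReal.ofReal_le_ofReal hq)
  have hGL2 : ∀ z, MemLp (G z) 2 P := fun z => hFL2.mono (hGm z).aestronglyMeasurable
    (ae_of_all _ fun w => by simpa [abs_of_nonneg (hF0 w)] using hGF z w)
  have hGint : ∀ z, Integrable (G z) P := fun z => (hGL2 z).integrable (by norm_num)
  have hG2int : ∀ z, Integrable (fun w => G z w ^ 2) P := fun z => (hGL2 z).integrable_sq
  -- the largest empirical second moment
  let V : (Fin n → 𝒲) → ℝ≥0∞ := fun x => ⨆ z, ENNReal.ofReal (empMean x fun w => G z w ^ 2)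
  have hVm : AEMeasurable V ν := by
    refine Measurable.aemeasurable_iSup_standardBorel
      (h := fun y : (Fin n → 𝒲) × Z => ENNReal.ofReal (empMean y.1 fun w => G y.2 w ^ 2)) ?_ _
    refine Measurable.ennreal_ofReal (Measurable.const_mul (Finset.measurable_sum _ fun i _ => ?_) _)
    exact (measurable_apply_of_jointly hG ((measurable_pi_apply i).comp measurable_fst)
      measurable_snd).pow_const 2
  have hemp : ∀ (x : Fin n → 𝒲) z, ∑ i, G z (x i) ^ 2 = n * empMean x fun w => G z w ^ 2 := by
    intro x z
    unfold empMean
    field_simp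
  have hVD : ∀ x, V x ≤ ENNReal.ofReal (D x) := by
    intro x
    refine iSup_le fun z => ENNReal.ofReal_le_ofReal ?_
    have h1 := (Finset.sum_le_sum fun i (_ : i ∈ Finset.univ) => hGsq z (x i)).trans (hFsum x)
    rw [hemp] at h1
    exact le_of_mul_le_mul_left h1 hn'
  have hVtop : ∀ x, V x ≠ ⊤ := fun x => ((hVD x).trans_lt ENNReal.ofReal_lt_top).ne
  have hVz : ∀ (x : Fin n → 𝒲) z, ∑ i, G z (x i) ^ 2 ≤ n * (V x).toReal := by
    intro x z
    rw [hemp]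
    gcongr
    refine (ENNReal.ofReal_le_iff_le_toReal (hVtop x)).1 ?_
    exact le_iSup (fun z => ENNReal.ofReal (empMean x fun w => G z w ^ 2)) z
  -- bound on the expectation of `V`
  have hstepV : ∫⁻ x, V x ∂ν ≤ ENNReal.ofReal (2 * (ρ ^ 2 + 24 * L * t ^ 2 / n)) := by
    have hsym := lintegral_iSup_empMean_sub_le P hn (fun z w => G z w ^ 2) (hG.pow_const 2) hG2int
      (fun x => 4⁻¹ * V x + ENNReal.ofReal (6 * L / n) * ENNReal.ofReal (D x))
      ((hVm.const_mul _).add (hDm.ennreal_ofReal.const_mul _).aemeasurable) ?_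
    · rw [lintegral_add_right _ (hDm.ennreal_ofReal.const_mul _), lintegral_const_mul'' _ hVm,
        lintegral_const_mul _ hDm.ennreal_ofReal] at hsym
      have hZ : ∫⁻ x, V x ∂ν ≠ ⊤ := ((lintegral_mono hVD).trans hDint).trans_lt
        ENNReal.ofReal_lt_top |>.ne
      have h1 : ∫⁻ x, V x ∂ν ≤ ENNReal.ofReal (ρ ^ 2) + ∫⁻ x : Fin n → 𝒲,
          ⨆ z, ‖empMean x (fun w => G z w ^ 2) - ∫ w, G z w ^ 2 ∂P‖ₑ ∂ν := by
        calc ∫⁻ x, V x ∂ν ≤ ∫⁻ x : Fin n → 𝒲, (ENNReal.ofReal (ρ ^ 2) +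
              ⨆ z, ‖empMean x (fun w => G z w ^ 2) - ∫ w, G z w ^ 2 ∂P‖ₑ) ∂ν := by
              refine lintegral_mono fun x => iSup_le fun z => ?_
              calc ENNReal.ofReal (empMean x fun w => G z w ^ 2)
                  ≤ ENNReal.ofReal (ρ ^ 2 + |empMean x (fun w => G z w ^ 2) - ∫ w, G z w ^ 2 ∂P|) := by
                    refine ENNReal.ofReal_le_ofReal ?_
                    linarith [le_abs_self (empMean x (fun w => G z w ^ 2) - ∫ w, G z w ^ 2 ∂P), hGρ z]
                _ = ENNReal.ofReal (ρ ^ 2) + ‖empMean x (fun w => G z w ^ 2) - ∫ w, G z w ^ 2 ∂P‖ₑ := by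
                    rw [ENNReal.ofReal_add (by positivity) (abs_nonneg _), Real.enorm_eq_ofReal_abs]
                _ ≤ _ := by
                    gcongr
                    exact le_iSup (fun z =>
                      ‖empMean x (fun w => G z w ^ 2) - ∫ w, G z w ^ 2 ∂P‖ₑ) z
          _ = _ := by
              rw [lintegral_add_left measurable_const]
              simp
      have h2 := h1.trans (add_le_add_right hsym _)
      have h3 : ENNReal.ofReal (6 * L / n) * ∫⁻ x, ENNReal.ofReal (D x) ∂ν
          ≤ ENNReal.ofReal (12 * L * t ^ 2 / n) := by
        refine (mul_le_mul_right hDint _).trans (le_of_eq ?_)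
        rw [← ENNReal.ofReal_mul (by positivity)]
        congr 1
        ring
      obtain ⟨Zr, hZr0, hZr⟩ : ∃ z : ℝ, 0 ≤ z ∧ ∫⁻ x, V x ∂ν = ENNReal.ofReal z :=
        ⟨_, ENNReal.toReal_nonneg, (ENNReal.ofReal_toReal hZ).symm⟩
      have h4 : ENNReal.ofReal Zr ≤ ENNReal.ofReal (ρ ^ 2 + 2 * (4⁻¹ * Zr + 12 * L * t ^ 2 / n)) := by
        rw [hZr] at h2
        refine h2.trans ?_
        rw [ENNReal.ofReal_add (by positivity) (by positivity), ENNReal.ofReal_mul (by norm_num),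
          ENNReal.ofReal_add (by positivity) (by positivity), ENNReal.ofReal_mul (by norm_num),
          ENNReal.ofReal_inv_of_pos (by norm_num)]
        simp only [ENNReal.ofReal_ofNat]
        gcongr
      rw [ENNReal.ofReal_le_ofReal_iff (by positivity)] at h4
      rw [hZr]
      refine ENNReal.ofReal_le_ofReal ?_
      have : 24 * L * t ^ 2 / n = 2 * (12 * L * t ^ 2 / n) := by ring
      rw [this]
      linarith
    · intro x
      obtain ⟨T, hT, hnet⟩ := hcov x
      have h1 := average_iSup_boolSign_le (fun z i => G z (x i) ^ 2) T (r := 4 * D x)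
        (s := D x * (n * (V x).toReal)) (L := L) (l := (2 * D x)⁻¹) (by have := hDpos x; positivity)
        (fun z => ?_) (fun z _ => ?_) hT (by have := hDpos x; positivity)
      · refine h1.trans ?_
        have hD := hDpos x
        have e : (n : ℝ)⁻¹ * (L / (2 * D x)⁻¹ + (2 * D x)⁻¹ * (D x * (n * (V x).toReal)) / 2 + 4 * D x)
            = 4⁻¹ * (V x).toReal + (2 * L + 4) / n * D x := by
          field_simp
          ring
        rw [e]
        have e2 : 4⁻¹ * (V x).toReal + (2 * L + 4) / n * D x
            ≤ 4⁻¹ * (V x).toReal + (6 * L) / n * D x := by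
          gcongr
          linarith
        refine (ENNReal.ofReal_le_ofReal e2).trans (le_of_eq ?_)
        rw [ENNReal.ofReal_add (by positivity) (by positivity), ENNReal.ofReal_mul (by norm_num),
          ENNReal.ofReal_mul (by positivity), ENNReal.ofReal_inv_of_pos (by norm_num),
          ENNReal.ofReal_toReal (hVtop x)]
        simp
      · obtain ⟨z', hz', hd⟩ := hnet z
        refine ⟨z', hz', ?_⟩
        have hS := hFsum x
        set S := ∑ i, F (x i) ^ 2
        have hS0 : 0 ≤ S := Finset.sum_nonneg fun i _ => sq_nonneg _
        have hcs : (∑ i, |G z (x i) - G z' (x i)| * F (x i)) ≤ 2 / n * S := by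
          have := Finset.sum_mul_sq_le_sq_mul_sq Finset.univ
            (fun i => |G z (x i) - G z' (x i)|) (fun i => F (x i))
          simp only [sq_abs] at this
          refine abs_le_of_sq_le_sq' (a := ∑ i, |G z (x i) - G z' (x i)| * F (x i)) ?_
            (by positivity) |>.2
          calc _ ≤ _ := this
            _ ≤ ((2 / n) ^ 2 * S) * S := mul_le_mul_of_nonneg_right hd hS0
            _ = _ := by ring
        calc ∑ i, |G z (x i) ^ 2 - G z' (x i) ^ 2|
            ≤ ∑ i, 2 * (|G z (x i) - G z' (x i)| * F (x i)) := by
              refine Finset.sum_le_sum fun i _ => ?_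
              rw [sq_sub_sq, abs_mul]
              have : |G z (x i) + G z' (x i)| ≤ 2 * F (x i) :=
                (abs_add_le _ _).trans (by linarith [hGF z (x i), hGF z' (x i)])
              nlinarith [abs_nonneg (G z (x i) - G z' (x i))]
          _ ≤ 2 * (2 / n * S) := by rw [← Finset.mul_sum]; gcongr
          _ ≤ 2 * (2 / n * (n * D x)) := by gcongr
          _ = 4 * D x := by field_simp; ring
      · calc ∑ i, (G z (x i) ^ 2) ^ 2 ≤ ∑ i, D x * G z (x i) ^ 2 := by
              refine Finset.sum_le_sum fun i _ => ?_
              rw [sq (G z (x i) ^ 2)]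
              exact mul_le_mul_of_nonneg_right ((hGsq z _).trans (hDF x i)) (sq_nonneg _)
          _ = D x * ∑ i, G z (x i) ^ 2 := by rw [Finset.mul_sum]
          _ ≤ _ := mul_le_mul_of_nonneg_left (hVz x z) (hDpos x).le
  -- the class itself
  set a := Real.sqrt (L / n) with ha
  have ha0 : 0 < a := Real.sqrt_pos.2 (by positivity)
  have ha2 : a ^ 2 = L / n := Real.sq_sqrt (by positivity)
  set κ := ρ + 7 * a * t with hκ
  have hκ0 : 0 < κ := by positivity
  have hsym := lintegral_iSup_empMean_sub_le P hn G hG hGint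
    (fun x => ENNReal.ofReal (a * κ + t / n) + (ENNReal.ofReal (a / κ / 2) * V x
      + ENNReal.ofReal (1 / (t * n)) * ENNReal.ofReal (D x)))
    (measurable_const.aemeasurable.add
      ((hVm.const_mul _).add (hDm.ennreal_ofReal.const_mul _).aemeasurable)) ?_
  · refine hsym.trans ?_
    rw [lintegral_add_left measurable_const, lintegral_add_right _ (hDm.ennreal_ofReal.const_mul _),
      lintegral_const_mul'' _ hVm, lintegral_const_mul _ hDm.ennreal_ofReal, lintegral_const,
      measure_univ, mul_one]
    calc _ ≤ 2 * (ENNReal.ofReal (a * κ + t / n) + (ENNReal.ofReal (a / κ / 2)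
            * ENNReal.ofReal (2 * (ρ ^ 2 + 24 * L * t ^ 2 / n))
          + ENNReal.ofReal (1 / (t * n)) * ENNReal.ofReal (2 * t ^ 2))) := by gcongr
      _ = ENNReal.ofReal (2 * (a * κ + t / n + (a / κ / 2 * (2 * (ρ ^ 2 + 24 * L * t ^ 2 / n))
          + 1 / (t * n) * (2 * t ^ 2)))) := by
          rw [← ENNReal.ofReal_mul (by positivity), ← ENNReal.ofReal_mul (by positivity),
            ← ENNReal.ofReal_add (by positivity) (by positivity),
            ← ENNReal.ofReal_add (by positivity) (by positivity),
            ENNReal.ofReal_mul (by norm_num : (0 : ℝ) ≤ 2)]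
          simp
      _ ≤ _ := by
          refine ENNReal.ofReal_le_ofReal ?_
          have h1 : ρ ^ 2 + 24 * L * t ^ 2 / n ≤ κ ^ 2 := by
            have : 24 * L * t ^ 2 / n = 24 * a ^ 2 * t ^ 2 := by rw [ha2]; ring
            rw [this, hκ]
            have h5 : 0 ≤ ρ * a * t := by positivity
            have h6 : 0 ≤ a ^ 2 * t ^ 2 := by positivity
            linarith [show (ρ + 7 * a * t) ^ 2 = ρ ^ 2 + 14 * (ρ * a * t) + 49 * (a ^ 2 * t ^ 2) by ring]
          have h2 : a / κ / 2 * (2 * (ρ ^ 2 + 24 * L * t ^ 2 / n)) ≤ a * κ := by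
            calc _ ≤ a / κ / 2 * (2 * κ ^ 2) := by gcongr
              _ = a * κ := by field_simp
          have h3 : 1 / (t * n) * (2 * t ^ 2) = 2 * (t / n) := by field_simp
          have h4 : a * κ = ρ * a + 7 * (L * t / n) := by
            rw [hκ, show a * (ρ + 7 * a * t) = ρ * a + 7 * a ^ 2 * t by ring, ha2]; ring
          have h5 : t / n ≤ L * t / n := by
            rw [div_le_div_iff_of_pos_right hn']
            nlinarith
          have h6 : L * K * (n : ℝ) ^ (1 / q) / n = L * t / n := by rw [ht]; ring
          rw [h6, h3]
          have h7 : 0 ≤ ρ * a := by positivity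
          linarith
  · intro x
    obtain ⟨T, hT, hnet⟩ := hcov x
    have hD := hDpos x
    have h1 := average_iSup_boolSign_le (fun z i => G z (x i)) T (r := D x / t + t)
      (s := n * (V x).toReal) (L := L) (l := a / κ) (by positivity)
      (fun z => ?_) (fun z _ => hVz x z) hT (by positivity)
    · refine h1.trans ?_
      have e : (n : ℝ)⁻¹ * (L / (a / κ) + a / κ * (n * (V x).toReal) / 2 + (D x / t + t))
          = a * κ + t / n + (a / κ / 2 * (V x).toReal + 1 / (t * n) * D x) := by
        have h8 : (n : ℝ)⁻¹ * (L / (a / κ)) = a * κ := by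
          rw [show (n : ℝ)⁻¹ * (L / (a / κ)) = (L / n) / (a / κ) by ring, ← ha2]
          field_simp
        rw [mul_add, mul_add, h8]
        field_simp
        ring
      rw [e, ENNReal.ofReal_add (by positivity) (by positivity),
        ENNReal.ofReal_add (show 0 ≤ a / κ / 2 * (V x).toReal by positivity)
          (show 0 ≤ 1 / (t * n) * D x by positivity),
        ENNReal.ofReal_mul (show 0 ≤ a / κ / 2 by positivity),
        ENNReal.ofReal_mul (show 0 ≤ 1 / (t * n) by positivity), ENNReal.ofReal_toReal (hVtop x)]
    · obtain ⟨z', hz', hd⟩ := hnet z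
      refine ⟨z', hz', ?_⟩
      have hcs := Finset.sum_mul_sq_le_sq_mul_sq Finset.univ
        (fun i => |G z (x i) - G z' (x i)|) (fun _ => (1 : ℝ))
      simp only [sq_abs, mul_one, one_pow, Finset.sum_const, Finset.card_univ, Fintype.card_fin,
        nsmul_eq_mul] at hcs
      refine abs_le_of_sq_le_sq' (a := ∑ i, |G z (x i) - G z' (x i)|) ?_ (by positivity) |>.2
      calc _ ≤ _ := hcs
        _ ≤ ((2 / n) ^ 2 * (n * D x)) * n := by
            gcongr
            exact hd.trans (by gcongr; exact hFsum x)
        _ = 4 * (D x / t * t) := by field_simp; norm_num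
        _ ≤ (D x / t + t) ^ 2 := by linarith [sq_nonneg (D x / t - t),
            show (D x / t + t) ^ 2 = (D x / t - t) ^ 2 + 4 * (D x / t * t) by ring]

/-! ### Classes of functions with uniform entropy bounds -/

/-- A uniform entropy bound yields nets with respect to the empirical `L²`-norm at any sample. -/
theorem UniformEntropyBound.exists_finset {𝒲 : Type*} {𝓕 : Set (𝒲 → ℝ)} {F : 𝒲 → ℝ} {v a : ℝ}
    (h : UniformEntropyBound 𝓕 F v a) {ε : ℝ} (hε : 0 < ε) (hε1 : ε ≤ 1) {n : ℕ} (hn : n ≠ 0)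
    (x : Fin n → 𝒲) :
    ∃ N : Finset (𝒲 → ℝ), (N.card : ℝ) ≤ Real.exp (v * Real.log (a / ε)) ∧
      ∀ f ∈ 𝓕, ∃ g ∈ N, ∑ i, (f (x i) - g (x i)) ^ 2 ≤ ε ^ 2 * ∑ i, F (x i) ^ 2 := by
  have hn' : (0 : ℝ) < n := by positivity
  let Q : 𝒲 →₀ ℝ≥0 := ∑ i, Finsupp.single (x i) ((n : ℝ≥0)⁻¹)
  have hQ1 : (Q.sum fun _ m => m) = 1 := by
    rw [← Finsupp.sum_finsetSum_index (fun _ => rfl) (fun _ _ _ => rfl)]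
    simp [hn]
  have hQ : ∀ f : 𝒲 → ℝ, (discreteL2 Q f) ^ 2 = (n : ℝ)⁻¹ * ∑ i, f (x i) ^ 2 := by
    intro f
    have e : (Q.sum fun w m => (m : ℝ) * f w ^ 2) = (n : ℝ)⁻¹ * ∑ i, f (x i) ^ 2 := by
      rw [← Finsupp.sum_finsetSum_index (by simp) (by intros; push_cast; ring), Finset.mul_sum]
      refine Finset.sum_congr rfl fun i _ => ?_
      rw [Finsupp.sum_single_index (by simp)]
      simp
    rw [discreteL2, Real.sq_sqrt] <;> rw [e]
    exact mul_nonneg (by positivity) (Finset.sum_nonneg fun i _ => sq_nonneg _)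
  have h0 := h ε hε hε1 Q hQ1
  rw [← EReal.log_exp ((v * Real.log (a / ε) : ℝ) : EReal), ENNReal.log_le_log_iff,
    EReal.exp_coe] at h0
  set c := coverNum (ε * discreteL2 Q F) 𝓕 Q with hc
  have hctop : c ≠ ⊤ := by
    intro h1
    rw [h1] at h0
    simp at h0
  obtain ⟨m, hm⟩ := ENat.ne_top_iff_exists.1 hctop
  have hlt : c < (m + 1 : ℕ) := by rw [← hm]; exact_mod_cast Nat.lt_succ_self m
  rw [hc, coverNum] at hlt
  simp only [iInf_lt_iff] at hlt
  obtain ⟨N, hN, hNm⟩ := hlt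
  have hNm' : N.card ≤ m := Nat.lt_succ_iff.1 (by exact_mod_cast hNm)
  refine ⟨N, ?_, fun f hf => ?_⟩
  · rw [← hm] at h0
    have h1 : ((m : ℕ) : ℝ≥0∞) ≤ ENNReal.ofReal (Real.exp (v * Real.log (a / ε))) := by
      simpa using h0
    rw [← ENNReal.ofReal_natCast, ENNReal.ofReal_le_ofReal_iff (Real.exp_pos _).le] at h1
    exact le_trans (by exact_mod_cast hNm') h1
  · obtain ⟨g, hg, hd⟩ := hN f hf
    refine ⟨g, hg, ?_⟩
    have h2 : (discreteL2 Q (f - g)) ^ 2 ≤ (ε * discreteL2 Q F) ^ 2 :=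
      pow_le_pow_left₀ (Real.sqrt_nonneg _) hd 2
    rw [mul_pow, hQ, hQ, mul_left_comm] at h2
    exact le_of_mul_le_mul_left h2 (inv_pos.2 hn')

/-- Replacing the points of a net by members of the class doubles the radius. -/
theorem exists_internal_net {𝒲 Z : Type*} {n : ℕ} (G : Z → 𝒲 → ℝ) (x : Fin n → 𝒲)
    (N : Finset (𝒲 → ℝ)) {r : ℝ} (hN : ∀ z, ∃ g ∈ N, ∑ i, (G z (x i) - g (x i)) ^ 2 ≤ r) :
    ∃ t : Finset Z, t.card ≤ N.card ∧
      ∀ z, ∃ z' ∈ t, ∑ i, (G z (x i) - G z' (x i)) ^ 2 ≤ 4 * r := by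
  classical
  rcases isEmpty_or_nonempty Z with hZ | hZ
  · exact ⟨∅, by simp, fun z => (hZ.false z).elim⟩
  have hrep : ∀ g : 𝒲 → ℝ, ∃ z : Z, (∃ z', ∑ i, (G z' (x i) - g (x i)) ^ 2 ≤ r) →
      ∑ i, (G z (x i) - g (x i)) ^ 2 ≤ r := by
    intro g
    by_cases h : ∃ z', ∑ i, (G z' (x i) - g (x i)) ^ 2 ≤ r
    · exact ⟨h.choose, fun _ => h.choose_spec⟩
    · exact ⟨Classical.arbitrary Z, fun h' => (h h').elim⟩
  choose rep hrep using hrep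
  refine ⟨N.image rep, Finset.card_image_le, fun z => ?_⟩
  obtain ⟨g, hg, hd⟩ := hN z
  refine ⟨rep g, Finset.mem_image_of_mem rep hg, ?_⟩
  have h2 := hrep g ⟨z, hd⟩
  calc ∑ i, (G z (x i) - G (rep g) (x i)) ^ 2
      ≤ ∑ i, (2 * (G z (x i) - g (x i)) ^ 2 + 2 * (G (rep g) (x i) - g (x i)) ^ 2) := by
        refine Finset.sum_le_sum fun i _ => ?_
        linarith [sq_nonneg ((G z (x i) - g (x i)) + (G (rep g) (x i) - g (x i))),
          show ((G z (x i) - g (x i)) + (G (rep g) (x i) - g (x i))) ^ 2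
            + (G z (x i) - G (rep g) (x i)) ^ 2
            = 2 * (G z (x i) - g (x i)) ^ 2 + 2 * (G (rep g) (x i) - g (x i)) ^ 2 by ring]
    _ ≤ 4 * r := by
        rw [Finset.sum_add_distrib, ← Finset.mul_sum, ← Finset.mul_sum]
        linarith

/-- The maximal inequality in the form of a tail bound. -/
theorem measure_exists_empMean_sub_gt_le_of_cover {𝒲 Z : Type*} [MeasurableSpace 𝒲]
    [MeasurableSpace Z] [StandardBorelSpace Z] (P : Measure 𝒲) [IsProbabilityMeasure P] {n : ℕ}
    (hn : n ≠ 0) {q K ρ L : ℝ} (hq : 2 ≤ q) (hK : 0 < K) (hρ : 0 ≤ ρ) (hL : 1 ≤ L)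
    (G : Z → 𝒲 → ℝ) (hG : Measurable fun x : 𝒲 × Z => G x.2 x.1)
    {F : 𝒲 → ℝ} (hFm : Measurable F) (hF0 : ∀ w, 0 ≤ F w) (hGF : ∀ z w, |G z w| ≤ F w)
    (hFK : eLpNorm F (ENNReal.ofReal q) P ≤ ENNReal.ofReal K)
    (hGρ : ∀ z, ∫ w, G z w ^ 2 ∂P ≤ ρ ^ 2)
    (hcov : ∀ x : Fin n → 𝒲, ∃ t : Finset Z, 2 * (t.card : ℝ) ≤ Real.exp L ∧ ∀ z, ∃ z' ∈ t,
      ∑ i, (G z (x i) - G z' (x i)) ^ 2 ≤ (2 / n) ^ 2 * ∑ i, F (x i) ^ 2) {A : ℝ} (hA : 0 < A) :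
    (Measure.pi fun _ : Fin n => P) {x | ∃ z,
        A * (34 * (ρ * Real.sqrt (L / n) + L * K * (n : ℝ) ^ (1 / q) / n))
          < |empMean x (G z) - ∫ w, G z w ∂P|} ≤ ENNReal.ofReal (1 / A) := by
  have hn' : (0 : ℝ) < n := by positivity
  have hE := lintegral_iSup_empMean_sub_le_of_cover P hn hq hK hρ hL G hG hFm hF0 hGF hFK hGρ hcov
  set b := 34 * (ρ * Real.sqrt (L / n) + L * K * (n : ℝ) ^ (1 / q) / n)
  have hb : 0 < b := by positivity
  have hm : AEMeasurable (fun x : Fin n → 𝒲 => ⨆ z, ‖empMean x (G z) - ∫ w, G z w ∂P‖ₑ)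
      (Measure.pi fun _ => P) := by
    refine Measurable.aemeasurable_iSup_standardBorel (h := fun y : (Fin n → 𝒲) × Z =>
      ‖empMean y.1 (G y.2) - ∫ w, G y.2 w ∂P‖ₑ) ?_ _
    refine Measurable.enorm (Measurable.sub
      (Measurable.const_mul (Finset.measurable_sum _ fun i _ => ?_) _) ?_)
    · exact measurable_apply_of_jointly hG ((measurable_pi_apply i).comp measurable_fst)
        measurable_snd
    · have hsw : StronglyMeasurable fun y : Z × 𝒲 => G y.1 y.2 :=
        (measurable_apply_of_jointly hG measurable_snd measurable_fst).stronglyMeasurable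
      exact (hsw.integral_prod_right' (ν := P)).measurable.comp measurable_snd
  have hmarkov := mul_meas_ge_le_lintegral₀ hm (ENNReal.ofReal (A * b))
  have hsub : {x : Fin n → 𝒲 | ∃ z, A * b < |empMean x (G z) - ∫ w, G z w ∂P|} ⊆
      {x | ENNReal.ofReal (A * b) ≤ ⨆ z, ‖empMean x (G z) - ∫ w, G z w ∂P‖ₑ} := by
    rintro x ⟨z, hz⟩
    refine le_trans ?_ (le_iSup (fun z => ‖empMean x (G z) - ∫ w, G z w ∂P‖ₑ) z)
    rw [Real.enorm_eq_ofReal_abs]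
    exact ENNReal.ofReal_le_ofReal hz.le
  refine (measure_mono hsub).trans ?_
  have h3 := hmarkov.trans hE
  rw [mul_comm, ← ENNReal.le_div_iff_mul_le (Or.inl (by simp; positivity)) (Or.inl (by simp)),
    ← ENNReal.ofReal_div_of_pos (by positivity)] at h3
  refine h3.trans (ENNReal.ofReal_le_ofReal (le_of_eq ?_))
  field_simp

/-- The logarithm of twice the squared covering number at radius `1/n` is at most `5 v log a`. -/
theorem two_mul_sq_exp_entropy_le {n : ℕ} {a v : ℝ} (hn : 3 ≤ n) (ha : (n : ℝ) ≤ a) (hv : 1 ≤ v)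
    {N : ℝ} (hN0 : 0 ≤ N) (hN : N ≤ Real.exp (v * Real.log (a / (n : ℝ)⁻¹))) :
    1 ≤ Real.log a ∧ 2 * N ≤ Real.exp (5 * (v * Real.log a)) ∧
      2 * N ^ 2 ≤ Real.exp (5 * (v * Real.log a)) := by
  have hn3 : (3 : ℝ) ≤ n := by exact_mod_cast hn
  have hn0 : (0 : ℝ) < n := by linarith
  have ha0 : 0 < a := by linarith
  have hlog : 1 ≤ Real.log a := by
    rw [Real.le_log_iff_exp_le ha0]
    linarith [Real.exp_one_lt_d9]
  have hvl : 1 ≤ v * Real.log a := by nlinarith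
  have h1 : v * Real.log (a / (n : ℝ)⁻¹) ≤ 2 * (v * Real.log a) := by
    rw [div_inv_eq_mul, Real.log_mul ha0.ne' hn0.ne']
    have : Real.log n ≤ Real.log a := Real.log_le_log hn0 ha
    nlinarith
  have h2 : N ≤ Real.exp (2 * (v * Real.log a)) := hN.trans (Real.exp_le_exp.2 h1)
  have h3 : (2 : ℝ) ≤ Real.exp (v * Real.log a) := by
    have := Real.add_one_le_exp (v * Real.log a)
    linarith
  have h4 : 1 ≤ Real.exp (2 * (v * Real.log a)) := Real.one_le_exp (by linarith)
  have e : Real.exp (5 * (v * Real.log a)) = Real.exp (v * Real.log a)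
      * Real.exp (2 * (v * Real.log a)) ^ 2 := by
    rw [← Real.exp_nat_mul, ← Real.exp_add]
    congr 1
    push_cast
    ring
  have h5 : 2 * Real.exp (2 * (v * Real.log a)) ^ 2 ≤ Real.exp (5 * (v * Real.log a)) := by
    rw [e]; gcongr
  refine ⟨hlog, le_trans ?_ h5, le_trans ?_ h5⟩
  · nlinarith
  · gcongr

section FunctionClass

variable {𝒲 : Type*} [MeasurableSpace 𝒲] (P : Measure 𝒲) [IsProbabilityMeasure P] {n : ℕ}
  {q K a v : ℝ} {𝓕 : Set (𝒲 → ℝ)} {F : 𝒲 → ℝ}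

/-- Tail bound for the centred empirical means over a class with a uniform entropy bound. -/
theorem measure_exists_empMean_sub_gt_le (hn : 3 ≤ n) (hq : 2 ≤ q) (hK : 0 < K)
    (ha : (n : ℝ) ≤ a) (hv : 1 ≤ v) (hmeas : SuitablyMeasurable 𝓕) (hFm : Measurable F)
    (hF : ∀ f ∈ 𝓕, ∀ w, |f w| ≤ F w)
    (hFK : eLpNorm F (ENNReal.ofReal q) P ≤ ENNReal.ofReal K) (hent : UniformEntropyBound 𝓕 F v a)
    {ρ : ℝ} (hρ : 0 ≤ ρ) (h𝓕ρ : ∀ f ∈ 𝓕, ∫ w, f w ^ 2 ∂P ≤ ρ ^ 2) {A : ℝ} (hA : 0 < A) :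
    (Measure.pi fun _ : Fin n => P) {x | ∃ f ∈ 𝓕,
        A * (34 * (ρ * Real.sqrt (5 * (v * Real.log a) / n)
          + 5 * (v * Real.log a) * K * (n : ℝ) ^ (1 / q) / n))
          < |empMean x f - ∫ w, f w ∂P|} ≤ ENNReal.ofReal (1 / A) := by
  have hn0 : n ≠ 0 := by omega
  rcases 𝓕.eq_empty_or_nonempty with h0 | ⟨f₀, hf₀⟩
  · simp [h0]
  have hF0 : ∀ w, 0 ≤ F w := fun w => (abs_nonneg _).trans (hF f₀ hf₀ w)
  obtain ⟨Y, _, _, T, hT, hTm⟩ := hmeas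
  have hTF : ∀ y, T y ∈ 𝓕 := fun y => hT ▸ mem_range_self y
  have hnpos : (0 : ℝ) < (n : ℝ)⁻¹ := by positivity
  have hn1 : (n : ℝ)⁻¹ ≤ 1 := inv_le_one_of_one_le₀ (by exact_mod_cast (by omega : 1 ≤ n))
  have hlog := (two_mul_sq_exp_entropy_le hn ha hv le_rfl (Real.exp_pos _).le).1
  have hL : 1 ≤ 5 * (v * Real.log a) := by nlinarith
  have h := measure_exists_empMean_sub_gt_le_of_cover P hn0 hq hK hρ hL T hTm hFm hF0
    (fun y => hF _ (hTF y)) hFK (fun y => h𝓕ρ _ (hTF y)) (fun x => ?_) hA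
  · refine le_trans (measure_mono ?_) h
    rintro x ⟨f, hf, hx⟩
    rw [← hT] at hf
    obtain ⟨y, rfl⟩ := hf
    exact ⟨y, hx⟩
  · obtain ⟨N, hNc, hN⟩ := hent.exists_finset hnpos hn1 hn0 x
    obtain ⟨t, htc, ht⟩ := exists_internal_net T x N fun y => hN _ (hTF y)
    refine ⟨t, ?_, fun z => ?_⟩
    · refine le_trans ?_ (two_mul_sq_exp_entropy_le hn ha hv (Nat.cast_nonneg _) hNc).2.1
      gcongr
    · obtain ⟨z', hz', hd⟩ := ht z
      refine ⟨z', hz', hd.trans (le_of_eq ?_)⟩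
      ring

/-- Tail bound for the centred empirical means over the differences of members of a class with a
uniform entropy bound whose `L²(P)`-distance is at most `ρ`. -/
theorem measure_exists_empMean_sub_sub_gt_le (hn : 3 ≤ n) (hq : 2 ≤ q) (hK : 0 < K)
    (ha : (n : ℝ) ≤ a) (hv : 1 ≤ v) (hmeas : SuitablyMeasurable 𝓕) (hFm : Measurable F)
    (hF : ∀ f ∈ 𝓕, ∀ w, |f w| ≤ F w)
    (hFK : eLpNorm F (ENNReal.ofReal q) P ≤ ENNReal.ofReal K) (hent : UniformEntropyBound 𝓕 F v a)
    {ρ : ℝ} (hρ : 0 ≤ ρ) {A : ℝ} (hA : 0 < A) :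
    (Measure.pi fun _ : Fin n => P) {x | ∃ f ∈ 𝓕, ∃ g ∈ 𝓕, ∫ w, (f w - g w) ^ 2 ∂P ≤ ρ ^ 2 ∧
        A * (34 * (ρ * Real.sqrt (5 * (v * Real.log a) / n)
          + 5 * (v * Real.log a) * (2 * K) * (n : ℝ) ^ (1 / q) / n))
          < |empMean x (fun w => f w - g w) - ∫ w, (f w - g w) ∂P|} ≤ ENNReal.ofReal (1 / A) := by
  classical
  have hn0 : n ≠ 0 := by omega
  rcases 𝓕.eq_empty_or_nonempty with h0 | ⟨f₀, hf₀⟩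
  · simp [h0]
  have hF0 : ∀ w, 0 ≤ F w := fun w => (abs_nonneg _).trans (hF f₀ hf₀ w)
  obtain ⟨Y, _, _, T, hT, hTm⟩ := hmeas
  have hTF : ∀ y, T y ∈ 𝓕 := fun y => hT ▸ mem_range_self y
  have hnpos : (0 : ℝ) < (n : ℝ)⁻¹ := by positivity
  have hn1 : (n : ℝ)⁻¹ ≤ 1 := inv_le_one_of_one_le₀ (by exact_mod_cast (by omega : 1 ≤ n))
  have hlog := (two_mul_sq_exp_entropy_le hn ha hv le_rfl (Real.exp_pos _).le).1
  have hL : 1 ≤ 5 * (v * Real.log a) := by nlinarith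
  -- the pairs of close members form a measurable subset of `Y × Y`
  let s : Set (Y × Y) := {y | ∫ w, (T y.1 w - T y.2 w) ^ 2 ∂P ≤ ρ ^ 2}
  have hs : MeasurableSet s := by
    have hsw : StronglyMeasurable fun y : (Y × Y) × 𝒲 => (T y.1.1 y.2 - T y.1.2 y.2) ^ 2 := by
      refine Measurable.stronglyMeasurable (Measurable.pow_const (Measurable.sub ?_ ?_) 2)
      · exact measurable_apply_of_jointly hTm measurable_snd (measurable_fst.comp measurable_fst)
      · exact measurable_apply_of_jointly hTm measurable_snd (measurable_snd.comp measurable_fst)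
    exact measurableSet_le (hsw.integral_prod_right' (ν := P)).measurable measurable_const
  have := hs.standardBorel
  let G : s → 𝒲 → ℝ := fun y w => T y.1.1 w - T y.1.2 w
  have hG : Measurable fun x : 𝒲 × s => G x.2 x.1 := by
    have hv2 : Measurable fun x : 𝒲 × s => (x.2 : Y × Y) := measurable_subtype_coe.comp measurable_snd
    refine Measurable.sub ?_ ?_
    · exact measurable_apply_of_jointly hTm measurable_fst (measurable_fst.comp hv2)
    · exact measurable_apply_of_jointly hTm measurable_fst (measurable_snd.comp hv2)
  have h2FK : eLpNorm (fun w => 2 * F w) (ENNReal.ofReal q) P ≤ ENNReal.ofReal (2 * K) := by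
    have : (fun w => 2 * F w) = (2 : ℝ) • F := rfl
    rw [this, eLpNorm_const_smul, ENNReal.ofReal_mul (by norm_num), Real.enorm_eq_ofReal (by norm_num)]
    gcongr
  have h := measure_exists_empMean_sub_gt_le_of_cover P hn0 hq (by positivity : 0 < 2 * K) hρ hL G hG
    (hFm.const_mul 2) (fun w => by have := hF0 w; positivity) (fun y w => ?_) h2FK (fun y => y.2)
    (fun x => ?_) hA
  · refine le_trans (measure_mono ?_) h
    rintro x ⟨f, hf, g, hg, hfg, hx⟩
    rw [← hT] at hf hg
    obtain ⟨y, rfl⟩ := hf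
    obtain ⟨y', rfl⟩ := hg
    exact ⟨⟨(y, y'), hfg⟩, hx⟩
  · refine (abs_sub _ _).trans ?_
    linarith [hF _ (hTF y.1.1) w, hF _ (hTF y.1.2) w]
  · obtain ⟨N, hNc, hN⟩ := hent.exists_finset hnpos hn1 hn0 x
    have hN2 : ∀ y : s, ∃ g ∈ (N ×ˢ N).image fun g => g.1 - g.2,
        ∑ i, (G y (x i) - g (x i)) ^ 2 ≤ (n : ℝ)⁻¹ ^ 2 * ∑ i, (2 * F (x i)) ^ 2 := by
      intro y
      obtain ⟨g, hg, hd⟩ := hN _ (hTF y.1.1)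
      obtain ⟨g', hg', hd'⟩ := hN _ (hTF y.1.2)
      refine ⟨g - g', Finset.mem_image.2 ⟨(g, g'), Finset.mk_mem_product hg hg', rfl⟩, ?_⟩
      calc ∑ i, (G y (x i) - (g - g') (x i)) ^ 2
          ≤ ∑ i, (2 * (T y.1.1 (x i) - g (x i)) ^ 2 + 2 * (T y.1.2 (x i) - g' (x i)) ^ 2) := by
            refine Finset.sum_le_sum fun i _ => ?_
            simp only [G, Pi.sub_apply]
            linarith [sq_nonneg ((T y.1.1 (x i) - g (x i)) + (T y.1.2 (x i) - g' (x i))),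
              show ((T y.1.1 (x i) - g (x i)) + (T y.1.2 (x i) - g' (x i))) ^ 2
                + (T y.1.1 (x i) - T y.1.2 (x i) - (g (x i) - g' (x i))) ^ 2
                = 2 * (T y.1.1 (x i) - g (x i)) ^ 2 + 2 * (T y.1.2 (x i) - g' (x i)) ^ 2 by ring]
        _ ≤ 4 * ((n : ℝ)⁻¹ ^ 2 * ∑ i, F (x i) ^ 2) := by
            rw [Finset.sum_add_distrib, ← Finset.mul_sum, ← Finset.mul_sum]
            linarith
        _ = _ := by
            simp_rw [mul_pow, ← Finset.mul_sum]
            ring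
    obtain ⟨t, htc, ht⟩ := exists_internal_net G x _ hN2
    refine ⟨t, ?_, fun z => ?_⟩
    · refine le_trans ?_ (two_mul_sq_exp_entropy_le hn ha hv (Nat.cast_nonneg _) hNc).2.2
      have h1 : t.card ≤ N.card ^ 2 := by
        refine htc.trans (Finset.card_image_le.trans (le_of_eq ?_))
        rw [Finset.card_product, sq]
      have h2 : (t.card : ℝ) ≤ (N.card : ℝ) ^ 2 := by exact_mod_cast h1
      linarith
    · obtain ⟨z', hz', hd⟩ := ht z
      refine ⟨z', hz', hd.trans (le_of_eq ?_)⟩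
      ring

end FunctionClass

/-! ### Linearization of the moment condition -/

/-- Second-order expansion along the segment from `(θ₀, 0)` to `(θ, 1)`. No interior point of `Θ`
is needed: the derivative in the first variable is two-sided by assumption, and all the others are
taken along segments. -/
theorem abs_sub_le_of_taylor_segment {g : ℝ × ℝ → ℝ} {Θ : Set ℝ} (hΘ : Θ.OrdConnected)
    (hg : ContDiffOn ℝ 2 g (Θ ×ˢ Icc (0 : ℝ) 1)) {θ₀ θ J b c : ℝ} (hθ₀ : θ₀ ∈ Θ) (hθ : θ ∈ Θ)
    (hJ : HasDerivAt (fun x => g (x, 0)) J θ₀)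
    (hb : |derivWithin (fun r => g (θ₀, r)) (Icc 0 1) 0| ≤ b)
    (hc : ∀ r ∈ Ico (0 : ℝ) 1,
      |iteratedDerivWithin 2 (fun r => g (θ₀ + r * (θ - θ₀), r)) (Icc 0 1) r| ≤ c) :
    |g (θ, 1) - g (θ₀, 0) - J * (θ - θ₀)| ≤ b + c / 2 := by
  set h : ℝ → ℝ := fun r => g (θ₀ + r * (θ - θ₀), r) with hh
  have hud : UniqueDiffOn ℝ (Icc (0 : ℝ) 1) := uniqueDiffOn_Icc one_pos
  have hmem0 : (0 : ℝ) ∈ Icc (0 : ℝ) 1 := by simp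
  have hseg : ∀ r ∈ Icc (0 : ℝ) 1, θ₀ + r * (θ - θ₀) ∈ Θ := by
    intro r hr
    have := hΘ.convex.add_smul_sub_mem hθ₀ hθ hr
    simpa using this
  have hmaps : MapsTo (fun r : ℝ => (θ₀ + r * (θ - θ₀), r)) (Icc 0 1) (Θ ×ˢ Icc (0 : ℝ) 1) :=
    fun r hr => ⟨hseg r hr, hr⟩
  have hhC : ContDiffOn ℝ 2 h (Icc 0 1) := by
    refine hg.comp (ContDiff.contDiffOn ?_) hmaps
    fun_prop
  have hd : DifferentiableWithinAt ℝ g (Θ ×ˢ Icc (0 : ℝ) 1) (θ₀, 0) :=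
    hg.differentiableOn (by norm_num) _ ⟨hθ₀, hmem0⟩
  obtain ⟨g', hg'⟩ := hd
  have h1 : HasDerivWithinAt h (g' (θ - θ₀, 1)) (Icc 0 1) 0 := by
    refine HasFDerivWithinAt.comp_hasDerivWithinAt (f := fun r : ℝ => (θ₀ + r * (θ - θ₀), r)) 0
      (t := Θ ×ˢ Icc (0 : ℝ) 1) (by simpa using hg') ?_ hmaps
    refine HasDerivAt.hasDerivWithinAt (HasDerivAt.prodMk ?_ (hasDerivAt_id' _))
    simpa using ((hasDerivAt_id' (0 : ℝ)).mul_const (θ - θ₀)).const_add θ₀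
  have h2 : HasDerivWithinAt (fun r => g (θ₀, r)) (g' (0, 1)) (Icc 0 1) 0 := by
    refine HasFDerivWithinAt.comp_hasDerivWithinAt (f := fun r : ℝ => (θ₀, r)) 0
      (t := Θ ×ˢ Icc (0 : ℝ) 1) hg' ?_ fun r hr => ⟨hθ₀, hr⟩
    exact HasDerivAt.hasDerivWithinAt (HasDerivAt.prodMk (hasDerivAt_const _ _) (hasDerivAt_id' _))
  have h3 : HasDerivWithinAt (fun r : ℝ => g (θ₀ + r * (θ - θ₀), 0)) (g' (θ - θ₀, 0)) (Icc 0 1) 0 := by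
    refine HasFDerivWithinAt.comp_hasDerivWithinAt (f := fun r : ℝ => (θ₀ + r * (θ - θ₀), (0 : ℝ))) 0
      (t := Θ ×ˢ Icc (0 : ℝ) 1) (by simpa using hg') ?_ fun r hr => ⟨hseg r hr, hmem0⟩
    refine HasDerivAt.hasDerivWithinAt (HasDerivAt.prodMk ?_ (hasDerivAt_const _ _))
    simpa using ((hasDerivAt_id' (0 : ℝ)).mul_const (θ - θ₀)).const_add θ₀
  have h4 : HasDerivWithinAt (fun r : ℝ => g (θ₀ + r * (θ - θ₀), 0)) (J * (θ - θ₀)) (Icc 0 1) 0 := by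
    refine HasDerivAt.hasDerivWithinAt (HasDerivAt.comp (h₂ := fun x => g (x, 0)) 0 ?_ ?_)
    · simpa using hJ
    · simpa using ((hasDerivAt_id' (0 : ℝ)).mul_const (θ - θ₀)).const_add θ₀
  have h5 : g' (θ - θ₀, 0) = J * (θ - θ₀) := (hud 0 hmem0).eq_deriv _ h3 h4
  have h6 : g' (θ - θ₀, 1) = J * (θ - θ₀) + g' (0, 1) := by
    rw [← h5, ← map_add]
    simp
  have h7 : |g' (0, 1)| ≤ b := by rwa [h2.derivWithin (hud 0 hmem0)] at hb
  have hu : uIcc (0 : ℝ) 1 = Icc 0 1 := uIcc_of_le zero_le_one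
  obtain ⟨x, hx, hT⟩ := taylor_mean_remainder_lagrange (f := h) (x₀ := 0) (x := 1) (n := 1)
    zero_ne_one (by rw [hu]; exact hhC.of_le (by norm_num))
    (by
      rw [hu]
      refine (hhC.differentiableOn_iteratedDerivWithin (by norm_num) hud).mono ?_
      rw [uIoo_of_lt one_pos]
      exact Ioo_subset_Icc_self)
  rw [hu] at hT
  rw [uIoo_of_lt one_pos] at hx
  have hx2 := hc x ⟨hx.1.le, hx.2⟩
  rw [taylorWithinEval_succ, taylor_within_zero_eval, iteratedDerivWithin_one,
    h1.derivWithin (hud 0 hmem0), h6] at hT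
  have e0 : h 0 = g (θ₀, 0) := by simp [hh]
  have e1 : h 1 = g (θ, 1) := by simp [hh]
  norm_num [e0, e1] at hT
  have e2 : g (θ, 1) - g (θ₀, 0) - J * (θ - θ₀)
      = g' (0, 1) + iteratedDerivWithin 2 h (Icc 0 1) x / 2 := by linarith
  rw [e2]
  refine (abs_add_le _ _).trans ?_
  rw [abs_div, abs_two]
  gcongr

theorem empMean_sub {𝒲 : Type*} {n : ℕ} (w : Fin n → 𝒲) (f g : 𝒲 → ℝ) :
    empMean w (fun x => f x - g x) = empMean w f - empMean w g := by
  simp [empMean, Finset.sum_sub_distrib, mul_sub]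

theorem empMean_const_mul {𝒲 : Type*} {n : ℕ} (w : Fin n → 𝒲) (c : ℝ) (f : 𝒲 → ℝ) :
    empMean w (fun x => c * f x) = c * empMean w f := by
  simp [empMean, ← Finset.mul_sum, mul_left_comm]

section Model

variable {𝒲 E : Type*} [MeasurableSpace 𝒲] [AddCommGroup E] [Module ℝ E] {d p n : ℕ}
  {k : Rates} {M : MomentModel 𝒲 E d p} {P : ProbabilityMeasure 𝒲}

theorem MomentConditions.abs_mean_sub_mean_le (hM : MomentConditions k n M P) {u : M.U} {j : Fin p}
    {θ : ℝ} (hθ : θ ∈ M.Θ u j) {η : E} (hη : η ∈ M.𝒯 P u j) :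
    |M.mean P u j θ η - M.mean P u j θ (M.η₀ P u j)|
      ≤ k.B₁ n * M.nrm P u j (η - M.η₀ P u j) := by
  have h := norm_image_sub_le_of_norm_deriv_le_segment_01
    (f := fun r : ℝ => M.mean P u j θ (M.η₀ P u j + r • (η - M.η₀ P u j)))
    (C := k.B₁ n * M.nrm P u j (η - M.η₀ P u j)) ?_ ?_
  · simpa using h
  · have h1 := (hM.smooth u j η hη).differentiableOn (by norm_num)
    refine DifferentiableOn.comp (f := fun r : ℝ => (θ, r)) h1
      (by fun_prop : Differentiable ℝ fun r : ℝ => (θ, r)).differentiableOn fun r hr => ⟨hθ, hr⟩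
  · exact fun r hr => hM.deriv_bound u j r hr θ hθ η hη

/-- Linearization of the moment function at the true parameters. -/
theorem MomentConditions.abs_mean_sub_linear_le (hM : MomentConditions k n M P) (hP : P ∈ M.Pset)
    {u : M.U} {j : Fin p} {θ : ℝ} (hθ : θ ∈ M.Θ u j) {η : E} (hη : η ∈ M.𝒯 P u j) :
    |M.mean P u j θ η - M.J P u j * (θ - M.θ₀ P u j)|
      ≤ k.C₀ * k.δ n * (Real.sqrt n)⁻¹
        + k.B₂ n * max (|θ - M.θ₀ P u j| ^ 2) (M.nrm P u j (η - M.η₀ P u j) ^ 2) / 2 := by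
  have hJ : HasDerivAt (fun θ => M.mean P u j θ (M.η₀ P u j)) (M.J P u j) (M.θ₀ P u j) := by
    refine DifferentiableAt.hasDerivAt ?_
    -- a derivative which is not zero cannot be the junk value
    by_contra h
    have h1 := (hM.J_bounds u j).1
    rw [MomentModel.J, deriv_zero_of_not_differentiableAt h, abs_zero] at h1
    exact absurd k.c₀_pos (not_lt.2 h1)
  have h := abs_sub_le_of_taylor_segment
    (g := fun x : ℝ × ℝ => M.mean P u j x.1 (M.η₀ P u j + x.2 • (η - M.η₀ P u j)))
    (M.Θ_interval u j) (hM.smooth u j η hη) (M.θ₀_mem P hP u j) hθ (by simpa using hJ)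
    (hM.orthogonal u j η hη).2 (fun r hr => hM.deriv2_bound u j r hr θ hθ η hη)
  simpa [hM.moment u j] using h

/-- Members of a suitably measurable class are measurable. -/
theorem SuitablyMeasurable.measurable {𝓕 : Set (𝒲 → ℝ)} (h : SuitablyMeasurable 𝓕) {f : 𝒲 → ℝ}
    (hf : f ∈ 𝓕) : Measurable f := by
  obtain ⟨Y, _, _, T, hT, hTm⟩ := h
  rw [← hT] at hf
  obtain ⟨y, rfl⟩ := hf
  exact measurable_apply_of_jointly hTm measurable_id measurable_const

theorem eLpNorm_two_eq_sqrt {μ : Measure 𝒲} {f : 𝒲 → ℝ} (hf : MemLp f 2 μ) :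
    eLpNorm f 2 μ = ENNReal.ofReal (Real.sqrt (∫ w, f w ^ 2 ∂μ)) := by
  rw [hf.eLpNorm_eq_integral_rpow_norm (by norm_num) (by norm_num), Real.sqrt_eq_rpow]
  simp

theorem NuisanceConditions.memLp {Ω : Type*} [MeasurableSpace Ω] {μ : Measure Ω}
    {ηhat : Ω → M.U → Fin p → E} (hN : NuisanceConditions k n M P μ ηhat) {f : 𝒲 → ℝ}
    (hf : f ∈ M.F₁ P) : MemLp f 2 (P : Measure 𝒲) ∧
      k.c₀ ≤ Real.sqrt (∫ w, f w ^ 2 ∂(P : Measure 𝒲)) ∧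
      ∫ w, f w ^ 2 ∂(P : Measure 𝒲) ≤ k.C₀ ^ 2 := by
  obtain ⟨h1, h2⟩ := hN.L2_bounds f hf
  have hm : MemLp f 2 (P : Measure 𝒲) :=
    ⟨(hN.suitablyMeasurable.measurable hf).aestronglyMeasurable, h2.trans_lt ENNReal.ofReal_lt_top⟩
  rw [eLpNorm_two_eq_sqrt hm] at h1 h2
  rw [ENNReal.ofReal_le_ofReal_iff (Real.sqrt_nonneg _)] at h1
  rw [ENNReal.ofReal_le_ofReal_iff k.C₀_pos.le] at h2
  exact ⟨hm, h1, (Real.sqrt_le_left k.C₀_pos.le).1 h2⟩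

/-- The Bahadur representation at samples at which the empirical means over `ℱ₁` deviate from the
means by at most `C₁ τₙ`, those over the differences of members with `L²`-distance at most
`(C₀ (C₃ B₁ₙ τₙ)^ω)^(1/2)` by at most `C₂ δₙ / √n`, and those of the true scores by at most
`C₄ 𝒮ₙ / √n`. -/
theorem bahadur_of_empMean_bounds {Ω : Type*} [MeasurableSpace Ω] {μ : Measure Ω}
    {ηhat : Ω → M.U → Fin p → E} (hn : 3 ≤ n) (hP : P ∈ M.Pset) (hM : MomentConditions k n M P)
    (hN : NuisanceConditions k n M P μ ηhat) {C₁ C₂ C₃ C₄ ε : ℝ} (hC₁ : 0 < C₁)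
    (hC₃ : C₃ = 2 * (2 + 2 * C₁ + k.C₀) / k.c₀ + 1)
    (hδ : k.δ n ≤ 1) (hτ : (Real.sqrt n)⁻¹ ≤ k.C₀ * k.τ n)
    (hid : (2 + 2 * C₁ + k.C₀) * (k.B₁ n * k.τ n) < k.c₀)
    (hlog : C₄ / k.c₀ < k.C₀ * Real.log n) (hε : ε ≤ k.δ n * (Real.sqrt n)⁻¹)
    {w : Fin n → 𝒲} {θc : M.U → Fin p → ℝ} {ηh : M.U → Fin p → E}
    (hηh : ∀ u j, ηh u j ∈ M.𝒯 P u j) (hθc : IsApproxZEstimate M ε w θc ηh)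
    (h₁ : ∀ f ∈ M.F₁ P, |empMean w f - ∫ x, f x ∂(P : Measure 𝒲)| ≤ C₁ * k.τ n)
    (h₂ : ∀ f ∈ M.F₁ P, ∀ g ∈ M.F₁ P,
      ∫ x, (f x - g x) ^ 2 ∂(P : Measure 𝒲) ≤ k.C₀ * (C₃ * (k.B₁ n * k.τ n)) ^ k.ω →
      |empMean w (fun x => f x - g x) - ∫ x, (f x - g x) ∂(P : Measure 𝒲)|
        ≤ C₂ * k.δ n * (Real.sqrt n)⁻¹)
    (h₃ : ∀ u j, |Real.sqrt n * empMean w (M.trueScore P u j)| ≤ C₄ * (M.S n P).toReal)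
    (u : M.U) (j : Fin p) :
    |Real.sqrt n * (M.σ P u j)⁻¹ * (θc u j - M.θ₀ P u j)
        - empProcess (P : Measure 𝒲) w (M.ψbar P u j)|
      ≤ (1 + 2 * (C₂ + k.C₀ + C₃ ^ 2 * k.C₀ / 2)) / k.c₀ * k.δ n := by
  have hn1 : 1 ≤ n := by omega
  have hs0 : 0 < Real.sqrt n := Real.sqrt_pos.2 (by positivity)
  have hC₀ := k.C₀_pos
  have hc₀ := k.c₀_pos
  have hδ0 := k.δ_pos n hn1
  have hτ0 := k.τ_pos n hn1
  have hB := k.one_le_B₁ n hn1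
  have hB₂ := k.B₂_pos n hn1
  set s := (Real.sqrt n)⁻¹ with hs
  have hsp : 0 < s := inv_pos.2 hs0
  have hss : Real.sqrt n * s = 1 := mul_inv_cancel₀ hs0.ne'
  set θ₀ := M.θ₀ P u j with hθ₀
  set η₀ := M.η₀ P u j with hη₀
  set η := ηh u j with hη
  set J := M.J P u j with hJ
  set Bτ := k.B₁ n * k.τ n with hBτ
  have hτB : k.τ n ≤ Bτ := by nlinarith
  have hBτ0 : 0 < Bτ := by linarith
  set C₃' := 2 + 2 * C₁ + k.C₀ with hC₃'
  have hC₃'0 : 0 < C₃' := by positivity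
  have hC₃pos : 1 ≤ C₃ := by
    rw [hC₃]
    have : 0 ≤ 2 * C₃' / k.c₀ := by positivity
    linarith
  have hθ₀m : θ₀ ∈ M.Θ u j := M.θ₀_mem P hP u j
  have hη₀m : η₀ ∈ M.𝒯 P u j := hN.η₀_mem u j
  have hηm : η ∈ M.𝒯 P u j := hηh u j
  have hηn : M.nrm P u j (η - η₀) ≤ k.τ n := hN.nrm_le u j η hηm
  obtain ⟨hJ1, hJ2⟩ := hM.J_bounds u j
  have hJ0 : J ≠ 0 := by
    intro h
    have h1 : k.c₀ ≤ |J| := hJ1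
    rw [h, abs_zero] at h1
    linarith
  have hJpos : 0 < |J| := abs_pos.2 hJ0
  have hmemF : ∀ θ ∈ M.Θ u j, ∀ η ∈ M.𝒯 P u j, (fun x => M.ψ u j x θ η) ∈ M.F₁ P :=
    fun θ hθ η hη => ⟨u, j, θ, hθ, η, hη, rfl⟩
  have htrue : M.trueScore P u j ∈ M.F₁ P := hmemF θ₀ hθ₀m η₀ hη₀m
  let e : ℝ → E → ℝ := fun θ η => empMean w fun x => M.ψ u j x θ η
  have hem : ∀ θ ∈ M.Θ u j, ∀ η ∈ M.𝒯 P u j, |e θ η - M.mean P u j θ η| ≤ C₁ * k.τ n :=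
    fun θ hθ η hη => h₁ _ (hmemF θ hθ η hη)
  set e₀ := empMean w (M.trueScore P u j) with he₀
  have hmom : ∫ x, M.trueScore P u j x ∂(P : Measure 𝒲) = 0 := hM.moment u j
  have he₀τ : |e₀| ≤ C₁ * k.τ n := by
    have := h₁ _ htrue
    rwa [hmom, sub_zero] at this
  obtain ⟨hθcm, hθcapp⟩ := hθc u j
  set θ₁ := θc u j with hθ₁
  -- the estimator nearly minimizes the empirical moment
  have hinf : ∀ θ ∈ M.Θ u j, |e θ₁ η| ≤ |e θ η| + k.δ n * s := by
    intro θ hθ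
    have h1 : (⨅ θ : M.Θ u j, |e θ η|) ≤ |e θ η| :=
      ciInf_le (f := fun θ : M.Θ u j => |e θ η|) ⟨0, by rintro _ ⟨θ, rfl⟩; exact abs_nonneg _⟩
        ⟨θ, hθ⟩
    have h2 : |e θ₁ η| - (⨅ θ : M.Θ u j, |e θ η|) ≤ ε := hθcapp
    linarith
  -- preliminary rate
  have hnuis : ∀ θ ∈ M.Θ u j, |M.mean P u j θ η - M.mean P u j θ η₀| ≤ Bτ := fun θ hθ =>
    (hM.abs_mean_sub_mean_le hθ hηm).trans (by rw [hBτ]; gcongr)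
  have hrate : |θ₁ - θ₀| ≤ C₃ * Bτ := by
    have a1 := abs_le.1 (hem θ₁ hθcm η hηm)
    have a2 := abs_le.1 (hem θ₀ hθ₀m η hηm)
    have a3 := abs_le.1 (hnuis θ₁ hθcm)
    have a4 := abs_le.1 (hnuis θ₀ hθ₀m)
    have a5 : M.mean P u j θ₀ η₀ = 0 := hM.moment u j
    have a6 : |e θ₀ η| ≤ Bτ + C₁ * k.τ n := abs_le.2 ⟨by linarith, by linarith⟩
    have a7 := abs_le.1 ((hinf θ₀ hθ₀m).trans (add_le_add_left a6 _))
    have a8 : k.δ n * s ≤ k.C₀ * Bτ := by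
      calc k.δ n * s ≤ 1 * s := by gcongr
        _ ≤ k.C₀ * k.τ n := by rw [one_mul]; exact hτ
        _ ≤ _ := by gcongr
    have a9 : C₁ * k.τ n ≤ C₁ * Bτ := by gcongr
    have a10 : |M.mean P u j θ₁ η₀| ≤ C₃' * Bτ := by
      rw [hC₃']
      refine abs_le.2 ⟨by linarith, by linarith⟩
    have a11 := (hM.identif u j θ₁ hθcm).trans a10
    rcases min_le_iff.1 a11 with h | h
    · have h' : 2⁻¹ * |J * (θ₁ - θ₀)| ≤ C₃' * Bτ := h
      rw [abs_mul] at h'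
      have h2 : k.c₀ * |θ₁ - θ₀| ≤ 2 * (C₃' * Bτ) := by
        have : k.c₀ * |θ₁ - θ₀| ≤ |J| * |θ₁ - θ₀| := by gcongr
        linarith
      have h3 : |θ₁ - θ₀| ≤ 2 * C₃' / k.c₀ * Bτ := by
        rw [div_mul_eq_mul_div, le_div_iff₀ hc₀]
        linarith
      rw [hC₃, add_mul]
      linarith
    · exact absurd hid (not_lt.2 h)
  -- linear expansion near the true parameter
  set C₅ := C₂ + k.C₀ + C₃ ^ 2 * k.C₀ / 2 with hC₅
  have hexp : ∀ θ ∈ M.Θ u j, |θ - θ₀| ≤ C₃ * Bτ →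
      |e θ η - e₀ - J * (θ - θ₀)| ≤ C₅ * (k.δ n * s) := by
    intro θ hθ hθr
    have hnn : 0 ≤ M.nrm P u j (η - η₀) := apply_nonneg _ _
    have hτC : k.τ n ≤ C₃ * Bτ := by nlinarith
    have b1 := h₂ _ (hmemF θ hθ η hηm) _ htrue (by
      refine (hM.meanSquare u j θ hθ η hηm).trans ?_
      have : max |θ - θ₀| (M.nrm P u j (η - η₀)) ≤ C₃ * Bτ := max_le hθr (hηn.trans hτC)
      have h0 : 0 ≤ max |θ - θ₀| (M.nrm P u j (η - η₀)) := le_max_of_le_left (abs_nonneg _)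
      exact mul_le_mul_of_nonneg_left (Real.rpow_le_rpow h0 this k.ω_pos.le) hC₀.le)
    rw [empMean_sub, integral_sub ((hN.memLp (hmemF θ hθ η hηm)).1.integrable (by norm_num))
      ((hN.memLp htrue).1.integrable (by norm_num)), hmom, sub_zero] at b1
    have b2 := hM.abs_mean_sub_linear_le hP hθ hηm
    have b3 : max (|θ - θ₀| ^ 2) (M.nrm P u j (η - η₀) ^ 2) ≤ (C₃ * Bτ) ^ 2 :=
      max_le (by gcongr) (by gcongr; exact hηn.trans hτC)
    have b4 : k.B₂ n * (C₃ * Bτ) ^ 2 ≤ C₃ ^ 2 * k.C₀ * (k.δ n * s) := by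
      have h1 := hN.growth_c
      have h2 : k.B₁ n ^ 2 * k.B₂ n * k.τ n ^ 2 ≤ k.C₀ * k.δ n * s := by
        calc k.B₁ n ^ 2 * k.B₂ n * k.τ n ^ 2
            = (Real.sqrt n * s) * (k.B₁ n ^ 2 * k.B₂ n * k.τ n ^ 2) := by rw [hss, one_mul]
          _ = (Real.sqrt n * k.B₁ n ^ 2 * k.B₂ n * k.τ n ^ 2) * s := by ring
          _ ≤ _ := by gcongr
      calc k.B₂ n * (C₃ * Bτ) ^ 2 = C₃ ^ 2 * (k.B₁ n ^ 2 * k.B₂ n * k.τ n ^ 2) := by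
            rw [hBτ]; ring
        _ ≤ C₃ ^ 2 * (k.C₀ * k.δ n * s) := by gcongr
        _ = _ := by ring
    have b5 : k.B₂ n * max (|θ - θ₀| ^ 2) (M.nrm P u j (η - η₀) ^ 2)
        ≤ C₃ ^ 2 * k.C₀ * (k.δ n * s) := (mul_le_mul_of_nonneg_left b3 hB₂.le).trans b4
    have b6 : |M.mean P u j θ η - J * (θ - θ₀)|
        ≤ k.C₀ * k.δ n * s + k.B₂ n * max (|θ - θ₀| ^ 2) (M.nrm P u j (η - η₀) ^ 2) / 2 := b2
    have b7 : |e θ η - e₀ - M.mean P u j θ η| ≤ C₂ * k.δ n * s := b1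
    have b8 := abs_le.1 b6
    have b9 := abs_le.1 b7
    have e1 : C₅ * (k.δ n * s) = C₂ * k.δ n * s + k.C₀ * k.δ n * s
        + C₃ ^ 2 * k.C₀ * (k.δ n * s) / 2 := by rw [hC₅]; ring
    rw [e1]
    exact abs_le.2 ⟨by linarith, by linarith⟩
  -- the solution of the linearized equation bounds the infimum of the empirical moment
  set θ₂ := θ₀ - J⁻¹ * e₀ with hθ₂
  have hθ₂d : |θ₂ - θ₀| = |J|⁻¹ * |e₀| := by
    rw [hθ₂, sub_sub_cancel_left, abs_neg, abs_mul, abs_inv]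
  have hJinv : |J|⁻¹ ≤ k.c₀⁻¹ := inv_anti₀ hc₀ hJ1
  have hθ₂r : |θ₂ - θ₀| ≤ C₃ * Bτ := by
    rw [hθ₂d, hC₃]
    calc |J|⁻¹ * |e₀| ≤ k.c₀⁻¹ * (C₁ * k.τ n) := by gcongr
      _ ≤ k.c₀⁻¹ * (C₁ * Bτ) := by gcongr
      _ = C₁ / k.c₀ * Bτ := by ring
      _ ≤ (2 * C₃' / k.c₀ + 1) * Bτ := by
          gcongr
          have : C₁ / k.c₀ ≤ 2 * C₃' / k.c₀ := by
            gcongr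
            rw [hC₃']
            linarith
          linarith
  have hθ₂m : θ₂ ∈ M.Θ u j := by
    have h3 := h₃ u j
    set S := (M.S n P).toReal with hS
    have hS0 : 0 ≤ S := ENNReal.toReal_nonneg
    rw [abs_mul, abs_of_pos hs0] at h3
    have h4 : |e₀| ≤ s * (C₄ * S) := by
      calc |e₀| = s * (Real.sqrt n * |e₀|) := by rw [← mul_assoc, mul_comm s, hss, one_mul]
        _ ≤ _ := by gcongr
    rcases hS0.eq_or_lt with h0 | h0
    · have : e₀ = 0 := by
        rw [← h0, mul_zero, mul_zero] at h4
        exact abs_nonpos_iff.1 h4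
      rw [hθ₂, this, mul_zero, sub_zero]
      exact hθ₀m
    · refine hM.ball_subset u j ?_
      rw [Metric.mem_ball, Real.dist_eq]
      change |θ₂ - θ₀| < k.C₀ * s * S * Real.log n
      rw [hθ₂d]
      calc |J|⁻¹ * |e₀| ≤ k.c₀⁻¹ * (s * (C₄ * S)) := by gcongr
        _ = (C₄ / k.c₀) * (s * S) := by ring
        _ < (k.C₀ * Real.log n) * (s * S) := by gcongr
        _ = _ := by ring
  have hθ₂e : |e θ₂ η| ≤ C₅ * (k.δ n * s) := by
    have h := hexp θ₂ hθ₂m hθ₂r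
    have e1 : e θ₂ η - e₀ - J * (θ₂ - θ₀) = e θ₂ η := by
      rw [hθ₂]
      field_simp
      ring
    rwa [e1] at h
  have hfin : |J * (θ₁ - θ₀) + e₀| ≤ (1 + 2 * C₅) * (k.δ n * s) := by
    have c1 := abs_le.1 (hexp θ₁ hθcm hrate)
    have c2 := abs_le.1 ((hinf θ₂ hθ₂m).trans (add_le_add_left hθ₂e _))
    exact abs_le.2 ⟨by linarith, by linarith⟩
  -- standardization
  set σ := M.σ P u j with hσ
  have hσJ : k.c₀ ≤ |σ * J| := by
    have h1 := (hN.memLp htrue).2.1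
    have h2 : |σ * J| = Real.sqrt (∫ x, M.trueScore P u j x ^ 2 ∂(P : Measure 𝒲)) := by
      rw [hσ, MomentModel.σ, Real.sqrt_mul (by positivity), Real.sqrt_inv, Real.sqrt_sq_eq_abs,
        abs_mul, abs_mul, abs_inv, abs_abs, abs_of_nonneg (Real.sqrt_nonneg _)]
      rw [mul_comm, ← mul_assoc]
      rw [mul_inv_cancel₀ hJpos.ne', one_mul]
    rwa [h2]
  have hG : empProcess (P : Measure 𝒲) w (M.ψbar P u j) = -(Real.sqrt n * (σ⁻¹ * J⁻¹ * e₀)) := by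
    have e1 : M.ψbar P u j = fun x => (-(σ⁻¹ * J⁻¹)) * M.trueScore P u j x := by
      funext x
      rw [neg_mul]
      rfl
    rw [empProcess, e1, empMean_const_mul, integral_const_mul, hmom]
    ring
  rw [hG]
  have e2 : Real.sqrt n * σ⁻¹ * (θ₁ - θ₀) - -(Real.sqrt n * (σ⁻¹ * J⁻¹ * e₀))
      = Real.sqrt n * ((σ * J)⁻¹ * (J * (θ₁ - θ₀) + e₀)) := by
    rw [mul_inv]
    field_simp
    ring
  rw [e2, abs_mul, abs_mul, abs_inv, abs_of_pos hs0]
  calc Real.sqrt n * (|σ * J|⁻¹ * |J * (θ₁ - θ₀) + e₀|)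
      ≤ Real.sqrt n * (k.c₀⁻¹ * ((1 + 2 * C₅) * (k.δ n * s))) := by
        gcongr
    _ = (Real.sqrt n * s) * ((1 + 2 * C₅) / k.c₀ * k.δ n) := by ring
    _ = _ := by rw [hss, one_mul]

end Model

/-! ### Tail bounds and rates -/

/-- Markov's inequality for the outer expectation, with `𝒮 = E X` also allowed to be zero. -/
theorem measure_outerExpectation_lt_le {Ω : Type*} [MeasurableSpace Ω] (μ : Measure Ω)
    (X : Ω → ℝ≥0∞) (hX : outerExpectation μ X ≠ ⊤) {A : ℝ} (hA : 0 < A) :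
    μ {ω | ENNReal.ofReal (A * (outerExpectation μ X).toReal) < X ω} ≤ ENNReal.ofReal (1 / A) := by
  have hmarkov : ∀ c : ℝ≥0∞, c * μ {ω | c ≤ X ω} ≤ outerExpectation μ X := by
    intro c
    refine le_iInf fun g => le_iInf fun hg => le_iInf fun hXg => ?_
    refine le_trans ?_ (mul_meas_ge_le_lintegral₀ hg.aemeasurable c)
    gcongr with ω
    exact hXg ω
  set S := outerExpectation μ X
  rcases eq_or_ne S 0 with h0 | h0
  · have hnull : ∀ m : ℕ, μ {ω | ((m : ℝ≥0∞) + 1)⁻¹ ≤ X ω} = 0 := by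
      intro m
      have h := hmarkov ((m : ℝ≥0∞) + 1)⁻¹
      rw [h0, nonpos_iff_eq_zero, mul_eq_zero] at h
      refine h.resolve_left (ENNReal.inv_ne_zero.2 (by finiteness))
    have hsub : {ω | ENNReal.ofReal (A * S.toReal) < X ω} ⊆ ⋃ m : ℕ, {ω | ((m : ℝ≥0∞) + 1)⁻¹ ≤ X ω} := by
      intro ω hω
      have h1 : 0 < X ω := lt_of_le_of_lt (zero_le) hω
      obtain ⟨m, hm⟩ := ENNReal.exists_inv_nat_lt h1.ne'
      refine mem_iUnion.2 ⟨m, le_trans ?_ hm.le⟩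
      gcongr
      exact le_self_add
    rw [measure_mono_null hsub (measure_iUnion_null hnull)]
    exact zero_le
  · have hS : 0 < S.toReal := ENNReal.toReal_pos h0 hX
    have h := hmarkov (ENNReal.ofReal (A * S.toReal))
    have e : ENNReal.ofReal (A * S.toReal) = ENNReal.ofReal A * S := by
      rw [ENNReal.ofReal_mul hA.le, ENNReal.ofReal_toReal hX]
    have h2 : ENNReal.ofReal A * μ {ω | ENNReal.ofReal (A * S.toReal) ≤ X ω} ≤ 1 := by
      rw [e] at h ⊢
      rw [mul_right_comm] at h
      refine (ENNReal.mul_le_mul_iff_left h0 hX).1 ?_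
      rwa [one_mul]
    refine (measure_mono fun ω (hω : _ < X ω) => hω.le).trans ?_
    rw [one_div, ENNReal.ofReal_inv_of_pos hA, ← one_div,
      ENNReal.le_div_iff_mul_le (Or.inl (by simpa using hA)) (Or.inl ENNReal.ofReal_ne_top), mul_comm]
    exact h2

/-- Outer probabilities of events which depend on a random sample are at most those under the
product measure. -/
theorem IsRandomSample.measure_preimage_le {𝒲 Ω : Type*} [MeasurableSpace 𝒲] [MeasurableSpace Ω]
    {n : ℕ} {W : Fin n → Ω → 𝒲} {P : Measure 𝒲} {μ : Measure Ω} (h : IsRandomSample W P μ)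
    (s : Set (Fin n → 𝒲)) : μ {ω | (fun i => W i ω) ∈ s} ≤ (Measure.pi fun _ : Fin n => P) s := by
  have := h.isProbabilityMeasure
  have h1 := (iIndepFun_iff_map_fun_eq_pi_map fun i => (h.measurable i).aemeasurable).1 h.indep
  simp_rw [h.map_eq] at h1
  rw [← h1]
  exact Measure.le_map_apply (measurable_pi_lambda _ h.measurable).aemeasurable s

section Model

variable {𝒲 E Ω : Type*} [MeasurableSpace 𝒲] [AddCommGroup E] [Module ℝ E] [MeasurableSpace Ω]
  {d p n : ℕ} {k : Rates} {M : MomentModel 𝒲 E d p} {P : ProbabilityMeasure 𝒲} {μ : Measure Ω}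
  {ηhat : Ω → M.U → Fin p → E}

/-- Consequences of the growth conditions for the rates of the maximal inequality. -/
theorem NuisanceConditions.rate_bounds (hn : 3 ≤ n) (hN : NuisanceConditions k n M P μ ηhat)
    (hδ : k.δ n ≤ 1) :
    (Real.sqrt n)⁻¹ ≤ k.C₀ * k.τ n ∧
    (k.B₁ n * k.τ n) ^ (k.ω / 2) ≤ k.C₀ * k.δ n ∧
    Real.sqrt (5 * (k.v n * Real.log (k.a n)) / n) ≤ 3 * (k.C₀ * k.τ n) ∧
    (k.B₁ n * k.τ n) ^ (k.ω / 2) * Real.sqrt (5 * (k.v n * Real.log (k.a n)) / n)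
      ≤ 3 * (k.C₀ * k.δ n * (Real.sqrt n)⁻¹) ∧
    k.v n * Real.log (k.a n) * k.K n * (n : ℝ) ^ (1 / k.q) / n ≤ k.C₀ * k.δ n * (Real.sqrt n)⁻¹ ∧
    k.v n * Real.log (k.a n) * k.K n * (n : ℝ) ^ (1 / k.q) / n ≤ k.C₀ * (k.C₀ * k.τ n) := by
  have hn1 : 1 ≤ n := by omega
  have hn0 : (0 : ℝ) < n := by positivity
  have hs0 : 0 < Real.sqrt n := Real.sqrt_pos.2 hn0
  have hv := k.one_le_v n hn1
  have ha : (n : ℝ) ≤ k.a n := (le_max_left _ _).trans (k.le_a n hn1)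
  have hlog := (two_mul_sq_exp_entropy_le hn ha hv le_rfl (Real.exp_pos _).le).1
  have hK := k.K_pos n hn1
  have hδ0 := k.δ_pos n hn1
  have hτ0 := k.τ_pos n hn1
  have hB := k.one_le_B₁ n hn1
  have hC₀ := k.C₀_pos
  have hω := k.ω_pos
  set l := k.v n * Real.log (k.a n) with hl
  have hl1 : 1 ≤ l := by nlinarith
  have hg := hN.growth_a
  rw [← hl] at hg
  have h1 : (Real.sqrt n)⁻¹ ≤ k.C₀ * k.τ n := by
    refine le_trans ?_ hg
    rw [← Real.sqrt_inv]
    refine Real.sqrt_le_sqrt ?_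
    rw [inv_eq_one_div]
    gcongr
  have hs5 : Real.sqrt (5 * l / n) ≤ 3 * Real.sqrt (l / n) := by
    rw [mul_div_assoc, Real.sqrt_mul (by norm_num)]
    gcongr
    rw [Real.sqrt_le_left (by norm_num)]
    norm_num
  have hBτ0 : 0 < k.B₁ n * k.τ n := by positivity
  set R := (k.B₁ n * k.τ n) ^ (k.ω / 2) with hR
  have hR0 : 0 ≤ R := Real.rpow_nonneg hBτ0.le _
  have hb := hN.growth_b
  have hSn : 0 ≤ (M.S n P).toReal * Real.log n / Real.sqrt n := by
    have : 0 ≤ Real.log n := Real.log_natCast_nonneg n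
    positivity
  have hR' : R ≤ (k.B₁ n * k.τ n + (M.S n P).toReal * Real.log n / Real.sqrt n) ^ (k.ω / 2) :=
    Real.rpow_le_rpow hBτ0.le (by linarith) (by positivity)
  set t₁ := (k.B₁ n * k.τ n + (M.S n P).toReal * Real.log n / Real.sqrt n) ^ (k.ω / 2)
    * Real.sqrt l
  set t₂ := (n : ℝ) ^ (-(1 / 2) + 1 / k.q) * k.v n * k.K n * Real.log (k.a n) with ht₂
  have hb' : t₁ + t₂ ≤ k.C₀ * k.δ n := hb
  have hRl : R * Real.sqrt l ≤ t₁ := mul_le_mul_of_nonneg_right hR' (Real.sqrt_nonneg _)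
  have ht₁0 : 0 ≤ t₁ := le_trans (by positivity) hRl
  have ht₂0 : 0 ≤ t₂ := by
    have : 0 ≤ Real.log (k.a n) := by linarith
    positivity
  have hRδ : R * Real.sqrt l ≤ k.C₀ * k.δ n := by linarith
  have h5 : l * k.K n * (n : ℝ) ^ (1 / k.q) / n = t₂ * (Real.sqrt n)⁻¹ := by
    rw [ht₂, hl, Real.rpow_add hn0, Real.rpow_neg hn0.le, ← Real.sqrt_eq_rpow]
    have : (n : ℝ) = Real.sqrt n * Real.sqrt n := (Real.mul_self_sqrt hn0.le).symm
    field_simp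
    rw [Real.sq_sqrt hn0.le]
  have h6 : l * k.K n * (n : ℝ) ^ (1 / k.q) / n ≤ k.C₀ * k.δ n * (Real.sqrt n)⁻¹ := by
    rw [h5]
    gcongr
    linarith
  refine ⟨h1, ?_, ?_, ?_, h6, ?_⟩
  · refine le_trans ?_ hRδ
    exact le_mul_of_one_le_right hR0 (Real.one_le_sqrt.2 hl1)
  · exact hs5.trans (by gcongr)
  · calc R * Real.sqrt (5 * l / n) ≤ R * (3 * Real.sqrt (l / n)) := by gcongr
      _ = 3 * (R * Real.sqrt l * (Real.sqrt n)⁻¹) := by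
          rw [Real.sqrt_div (by positivity)]
          ring
      _ ≤ _ := by gcongr
  · refine h6.trans ?_
    rw [mul_assoc]
    refine mul_le_mul_of_nonneg_left ?_ hC₀.le
    calc k.δ n * (Real.sqrt n)⁻¹ ≤ 1 * (Real.sqrt n)⁻¹ := by gcongr
      _ ≤ _ := by rw [one_mul]; exact h1

/-- With high probability the empirical means over `ℱ₁` deviate from the means by `O(τₙ)`. -/
theorem NuisanceConditions.measure_F₁_le (hn : 3 ≤ n) (hN : NuisanceConditions k n M P μ ηhat)
    (hδ : k.δ n ≤ 1) {A : ℝ} (hA : 0 < A) :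
    (Measure.pi fun _ : Fin n => (P : Measure 𝒲)) {x | ∃ f ∈ M.F₁ P,
      A * (272 * k.C₀ ^ 2) * k.τ n < |empMean x f - ∫ w, f w ∂(P : Measure 𝒲)|}
      ≤ ENNReal.ofReal (1 / A) := by
  have hn1 : 1 ≤ n := by omega
  obtain ⟨F, hFm, hF, hFK, hent⟩ := hN.entropy
  refine le_trans (measure_mono ?_) (measure_exists_empMean_sub_gt_le (P : Measure 𝒲) hn k.two_le_q
    (k.K_pos n hn1) ((le_max_left _ _).trans (k.le_a n hn1)) (k.one_le_v n hn1)
    hN.suitablyMeasurable hFm hF hFK hent k.C₀_pos.le (fun f hf => (hN.memLp hf).2.2) hA)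
  rintro x ⟨f, hf, hx⟩
  refine ⟨f, hf, lt_of_le_of_lt ?_ hx⟩
  obtain ⟨-, -, h3, -, -, h6⟩ := hN.rate_bounds hn hδ
  have hC₀ := k.C₀_pos
  rw [mul_assoc A]
  refine mul_le_mul_of_nonneg_left ?_ hA.le
  have h7 := mul_le_mul_of_nonneg_left h3 hC₀.le
  have e : 5 * (k.v n * Real.log (k.a n)) * k.K n * (n : ℝ) ^ (1 / k.q) / n
      = 5 * (k.v n * Real.log (k.a n) * k.K n * (n : ℝ) ^ (1 / k.q) / n) := by ring
  rw [e]
  linarith [show k.C₀ * (3 * (k.C₀ * k.τ n)) = 3 * (k.C₀ ^ 2 * k.τ n) by ring,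
    show k.C₀ * (k.C₀ * k.τ n) = k.C₀ ^ 2 * k.τ n by ring]

/-- With high probability the empirical process over differences of members of `ℱ₁` at distance
`O((B₁ₙ τₙ)^(ω/2))` is `O(δₙ)`. -/
theorem NuisanceConditions.measure_F₁_sub_le (hn : 3 ≤ n) (hN : NuisanceConditions k n M P μ ηhat)
    (hδ : k.δ n ≤ 1) {C₃ : ℝ} (hC₃ : 0 < C₃) {A : ℝ} (hA : 0 < A) :
    (Measure.pi fun _ : Fin n => (P : Measure 𝒲)) {x | ∃ f ∈ M.F₁ P, ∃ g ∈ M.F₁ P,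
      ∫ w, (f w - g w) ^ 2 ∂(P : Measure 𝒲) ≤ k.C₀ * (C₃ * (k.B₁ n * k.τ n)) ^ k.ω ∧
      A * (34 * k.C₀ * (3 * (Real.sqrt k.C₀ * C₃ ^ (k.ω / 2)) + 10)) * k.δ n * (Real.sqrt n)⁻¹
        < |empMean x (fun w => f w - g w) - ∫ w, (f w - g w) ∂(P : Measure 𝒲)|}
      ≤ ENNReal.ofReal (1 / A) := by
  have hn1 : 1 ≤ n := by omega
  obtain ⟨F, hFm, hF, hFK, hent⟩ := hN.entropy
  have hC₀ := k.C₀_pos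
  have hBτ : 0 < k.B₁ n * k.τ n := mul_pos (by linarith [k.one_le_B₁ n hn1]) (k.τ_pos n hn1)
  set ρ := Real.sqrt k.C₀ * C₃ ^ (k.ω / 2) * (k.B₁ n * k.τ n) ^ (k.ω / 2) with hρ
  have hρ0 : 0 ≤ ρ := by positivity
  have hρ2 : ρ ^ 2 = k.C₀ * (C₃ * (k.B₁ n * k.τ n)) ^ k.ω := by
    rw [hρ, mul_pow, mul_pow, Real.sq_sqrt hC₀.le, ← Real.rpow_natCast, ← Real.rpow_natCast,
      ← Real.rpow_mul hC₃.le, ← Real.rpow_mul hBτ.le, Real.mul_rpow hC₃.le hBτ.le]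
    norm_num
    ring
  refine le_trans (measure_mono ?_) (measure_exists_empMean_sub_sub_gt_le (P : Measure 𝒲) hn
    k.two_le_q (k.K_pos n hn1) ((le_max_left _ _).trans (k.le_a n hn1)) (k.one_le_v n hn1)
    hN.suitablyMeasurable hFm hF hFK hent hρ0 hA)
  rintro x ⟨f, hf, g, hg, hfg, hx⟩
  refine ⟨f, hf, g, hg, by rwa [hρ2], lt_of_le_of_lt ?_ hx⟩
  obtain ⟨-, -, -, h4, h5, -⟩ := hN.rate_bounds hn hδ
  rw [mul_assoc A, mul_assoc A]
  refine mul_le_mul_of_nonneg_left ?_ hA.le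
  have h7 := mul_le_mul_of_nonneg_left h4
    (by positivity : 0 ≤ Real.sqrt k.C₀ * C₃ ^ (k.ω / 2))
  have e : 5 * (k.v n * Real.log (k.a n)) * (2 * k.K n) * (n : ℝ) ^ (1 / k.q) / n
      = 10 * (k.v n * Real.log (k.a n) * k.K n * (n : ℝ) ^ (1 / k.q) / n) := by ring
  rw [e, hρ, mul_assoc (Real.sqrt k.C₀ * C₃ ^ (k.ω / 2))]
  calc _ ≤ 34 * (Real.sqrt k.C₀ * C₃ ^ (k.ω / 2) * (3 * (k.C₀ * k.δ n * (Real.sqrt n)⁻¹))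
        + 10 * (k.C₀ * k.δ n * (Real.sqrt n)⁻¹)) := by gcongr
    _ = _ := by ring

end Model

/-- With high probability the empirical means of all true scores are `O(𝒮ₙ / √n)`. -/
theorem MomentConditions.measure_trueScore_le {𝒲 E : Type*} [MeasurableSpace 𝒲] [AddCommGroup E]
    [Module ℝ E] {d p n : ℕ} {k : Rates} {M : MomentModel 𝒲 E d p} {P : ProbabilityMeasure 𝒲}
    (hM : MomentConditions k n M P) {A : ℝ} (hA : 0 < A) :
    (Measure.pi fun _ : Fin n => (P : Measure 𝒲)) {x | ∃ u j,
      A * (M.S n P).toReal < |Real.sqrt n * empMean x (M.trueScore P u j)|}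
      ≤ ENNReal.ofReal (1 / A) := by
  refine le_trans (measure_mono ?_) (measure_outerExpectation_lt_le _ _ hM.S_ne_top hA)
  rintro x ⟨u, j, hx⟩
  change ENNReal.ofReal _ < _
  refine lt_of_lt_of_le ?_ (le_iSup₂ (f := fun (u : M.U) (j : Fin p) =>
    ‖Real.sqrt n * empMean x (M.trueScore P u j)‖ₑ) u j)
  rw [Real.enorm_eq_ofReal_abs]
  refine (ENNReal.ofReal_lt_ofReal_iff_of_nonneg (by positivity)).2 hx

/-! ### Uniformity in the distribution -/

theorem theorem2p1
    (𝒲 E Ω : ℕ → Type*) [∀ n, MeasurableSpace (𝒲 n)] [∀ n, AddCommGroup (E n)]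
    [∀ n, Module ℝ (E n)] [∀ n, MeasurableSpace (Ω n)] (d p : ℕ → ℕ)
    -- the model at each sample size, and the constants
    (M : ∀ n, MomentModel (𝒲 n) (E n) (d n) (p n)) (k : Rates)
    -- a random sample `W n 0, …, W n (n - 1)` from `P` under the probability measure `Pr n P`
    (W : ∀ n, Fin n → Ω n → 𝒲 n) (Pr : ∀ n, ProbabilityMeasure (𝒲 n) → Measure (Ω n))
    (hW : ∀ n, k.n₀ ≤ n → ∀ P ∈ (M n).Pset, IsRandomSample (W n) (P : Measure (𝒲 n)) (Pr n P))
    -- the estimators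
    (ηhat : ∀ n, Ω n → (M n).U → Fin (p n) → E n)
    (θcheck : ∀ n, Ω n → (M n).U → Fin (p n) → ℝ)
    (ε : ℕ → ℝ) (hε : ε =o[Filter.atTop] fun n => k.δ n * (Real.sqrt n)⁻¹)
    (hθcheck : ∀ n, k.n₀ ≤ n → ∀ P ∈ (M n).Pset, ∀ᵐ ω ∂(Pr n P),
      IsApproxZEstimate (M n) (ε n) (fun i => W n i ω) (θcheck n ω) (ηhat n ω))
    -- the assumptions
    (hmoment : ∀ n, k.n₀ ≤ n → ∀ P ∈ (M n).Pset, MomentConditions k n (M n) P)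
    (hnuisance : ∀ n, k.n₀ ≤ n → ∀ P ∈ (M n).Pset,
      NuisanceConditions k n (M n) P (Pr n P) (ηhat n)) :
    UniformBigOP (fun n => (M n).Pset) Pr
      (fun n P ω => ⨆ (u : (M n).U) (j : Fin (p n)),
        ‖Real.sqrt n * ((M n).σ P u j)⁻¹ * (θcheck n ω u j - (M n).θ₀ P u j)
          - empProcess (P : Measure (𝒲 n)) (fun i => W n i ω) ((M n).ψbar P u j)‖ₑ)
      k.δ := by
  intro ε' hε'
  set A : ℝ := 6 / ε' with hA
  have hA0 : 0 < A := by positivity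
  have hC₀ := k.C₀_pos
  have hc₀ := k.c₀_pos
  set C₁ := A * (272 * k.C₀ ^ 2) with hC₁
  have hC₁0 : 0 < C₁ := by positivity
  set C₃ := 2 * (2 + 2 * C₁ + k.C₀) / k.c₀ + 1 with hC₃
  have hC₃0 : 0 < C₃ := by positivity
  set C₂ := A * (34 * k.C₀ * (3 * (Real.sqrt k.C₀ * C₃ ^ (k.ω / 2)) + 10)) with hC₂
  have hC₂0 : 0 < C₂ := by positivity
  refine ⟨(1 + 2 * (C₂ + k.C₀ + C₃ ^ 2 * k.C₀ / 2)) / k.c₀, by positivity, ?_⟩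
  -- a lower bound for the rate `B₁ₙ τₙ` would keep `δₙ` away from zero
  set κ := (k.c₀ / (2 + 2 * C₁ + k.C₀)) ^ (k.ω / 2) with hκ
  have hκ0 : 0 < κ := by positivity
  have ev1 : ∀ᶠ n in atTop, k.δ n < min 1 (κ / k.C₀) :=
    k.δ_tendsto.eventually_lt_const (by positivity)
  have ev2 : ∀ᶠ n in atTop, k.Δ n < ε' / 2 := k.Δ_tendsto.eventually_lt_const (by positivity)
  have ev3 : ∀ᶠ n : ℕ in atTop, A / k.c₀ / k.C₀ < Real.log n :=
    (Real.tendsto_log_atTop.comp tendsto_natCast_atTop_atTop).eventually_gt_atTop _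
  have ev4 : ∀ᶠ n in atTop, ‖ε n‖ ≤ 1 * ‖k.δ n * (Real.sqrt n)⁻¹‖ := hε.bound one_pos
  obtain ⟨N, hN⟩ := eventually_atTop.1
    (((ev1.and ev2).and (ev3.and ev4)).and (eventually_ge_atTop k.n₀))
  refine ⟨N, fun n hNn P hP => ?_⟩
  obtain ⟨⟨⟨h1, h2⟩, h3, h4⟩, hn₀⟩ := hN n hNn
  have hn3 : 3 ≤ n := k.three_le_n₀.trans hn₀
  have hδ0 := k.δ_pos n (by omega)
  have hδ1 : k.δ n ≤ 1 := h1.le.trans (min_le_left _ _)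
  have hδκ : k.C₀ * k.δ n < κ := by
    have := h1.trans_le (min_le_right _ _)
    rwa [lt_div_iff₀ hC₀, mul_comm] at this
  have hM := hmoment n hn₀ P hP
  have hNu := hnuisance n hn₀ P hP
  have hWn := hW n hn₀ P hP
  obtain ⟨hr1, hr2, -⟩ := hNu.rate_bounds hn3 hδ1
  have hεn : ε n ≤ k.δ n * (Real.sqrt n)⁻¹ := by
    rw [one_mul, Real.norm_eq_abs, Real.norm_eq_abs,
      abs_of_nonneg (by positivity : 0 ≤ k.δ n * (Real.sqrt n)⁻¹)] at h4
    exact (le_abs_self _).trans h4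
  have hid : (2 + 2 * C₁ + k.C₀) * (k.B₁ n * k.τ n) < k.c₀ := by
    rw [mul_comm, ← lt_div_iff₀ (by positivity)]
    by_contra! h
    have := Real.rpow_le_rpow (by positivity) h (by have := k.ω_pos; positivity : 0 ≤ k.ω / 2)
    linarith
  have hlog : A / k.c₀ < k.C₀ * Real.log n := by
    rw [div_lt_iff₀ hC₀] at h3
    linarith
  let w : Ω n → Fin n → 𝒲 n := fun ω i => W n i ω
  let b₁ : Set (Fin n → 𝒲 n) := {x | ∃ f ∈ (M n).F₁ P,
    C₁ * k.τ n < |empMean x f - ∫ y, f y ∂(P : Measure (𝒲 n))|}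
  let b₂ : Set (Fin n → 𝒲 n) := {x | ∃ f ∈ (M n).F₁ P, ∃ g ∈ (M n).F₁ P,
    ∫ y, (f y - g y) ^ 2 ∂(P : Measure (𝒲 n)) ≤ k.C₀ * (C₃ * (k.B₁ n * k.τ n)) ^ k.ω ∧
    C₂ * k.δ n * (Real.sqrt n)⁻¹
      < |empMean x (fun y => f y - g y) - ∫ y, (f y - g y) ∂(P : Measure (𝒲 n))|}
  let b₃ : Set (Fin n → 𝒲 n) := {x | ∃ u j,
    A * ((M n).S n P).toReal < |Real.sqrt n * empMean x ((M n).trueScore P u j)|}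
  let good : Set (Ω n) := {ω | IsApproxZEstimate (M n) (ε n) (w ω) (θcheck n ω) (ηhat n ω)}
  let hmem : Set (Ω n) := {ω | ¬ ∀ u j, ηhat n ω u j ∈ (M n).𝒯 P u j}
  have hsub : {ω | ENNReal.ofReal
      ((1 + 2 * (C₂ + k.C₀ + C₃ ^ 2 * k.C₀ / 2)) / k.c₀ * k.δ n)
        < ⨆ (u : (M n).U) (j : Fin (p n)),
        ‖Real.sqrt n * ((M n).σ P u j)⁻¹ * (θcheck n ω u j - (M n).θ₀ P u j)
          - empProcess (P : Measure (𝒲 n)) (fun i => W n i ω) ((M n).ψbar P u j)‖ₑ} ⊆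
      goodᶜ ∪ (hmem ∪ ({ω | w ω ∈ b₁} ∪ ({ω | w ω ∈ b₂} ∪ {ω | w ω ∈ b₃}))) := by
    intro ω hω
    by_contra hcon
    simp only [mem_union, not_or] at hcon
    obtain ⟨c0, c1, c2, c3, c4⟩ := hcon
    have c0' : IsApproxZEstimate (M n) (ε n) (w ω) (θcheck n ω) (ηhat n ω) := by
      by_contra h; exact c0 h
    have c1' : ∀ u j, ηhat n ω u j ∈ (M n).𝒯 P u j := by
      by_contra h; exact c1 h
    have hlt : ENNReal.ofReal _ < _ := hω
    refine absurd hlt (not_lt.2 (iSup₂_le fun u j => ?_))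
    rw [Real.enorm_eq_ofReal_abs]
    refine ENNReal.ofReal_le_ofReal ?_
    refine bahadur_of_empMean_bounds hn3 hP hM hNu hC₁0 hC₃ hδ1 hr1 hid hlog hεn c1' c0'
      (fun f hf => ?_) (fun f hf g hg hfg => ?_) (fun u j => ?_) u j
    · by_contra! h; exact c2 ⟨f, hf, h⟩
    · by_contra! h; exact c3 ⟨f, hf, g, hg, hfg, h⟩
    · by_contra! h; exact c4 ⟨u, j, h⟩
  have p0 : Pr n P goodᶜ = 0 := hθcheck n hn₀ P hP
  have p1 : Pr n P hmem ≤ ENNReal.ofReal (ε' / 2) :=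
    hNu.ηhat_mem.trans (ENNReal.ofReal_le_ofReal h2.le)
  have p2 : Pr n P {ω | w ω ∈ b₁} ≤ ENNReal.ofReal (1 / A) :=
    (hWn.measure_preimage_le b₁).trans (hNu.measure_F₁_le hn3 hδ1 hA0)
  have p3 : Pr n P {ω | w ω ∈ b₂} ≤ ENNReal.ofReal (1 / A) :=
    (hWn.measure_preimage_le b₂).trans (hNu.measure_F₁_sub_le hn3 hδ1 hC₃0 hA0)
  have p4 : Pr n P {ω | w ω ∈ b₃} ≤ ENNReal.ofReal (1 / A) :=
    (hWn.measure_preimage_le b₃).trans (hM.measure_trueScore_le hA0)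
  refine (measure_mono hsub).trans ?_
  calc _ ≤ Pr n P goodᶜ + (Pr n P hmem + (Pr n P {ω | w ω ∈ b₁}
        + (Pr n P {ω | w ω ∈ b₂} + Pr n P {ω | w ω ∈ b₃}))) := by
        refine (measure_union_le _ _).trans (add_le_add_right ((measure_union_le _ _).trans
          (add_le_add_right ((measure_union_le _ _).trans
            (add_le_add_right (measure_union_le _ _) _)) _)) _)
    _ ≤ 0 + (ENNReal.ofReal (ε' / 2) + (ENNReal.ofReal (1 / A)
        + (ENNReal.ofReal (1 / A) + ENNReal.ofReal (1 / A)))) := by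
        rw [p0]
        gcongr
    _ = ENNReal.ofReal ε' := by
        rw [zero_add, ← ENNReal.ofReal_add (by positivity) (by positivity),
          ← ENNReal.ofReal_add (by positivity) (by positivity),
          ← ENNReal.ofReal_add (by positivity) (by positivity)]
        congr 1
        rw [hA]
        field_simp
        norm_num
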